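/- **Setting.** Let $T\ge 1$, $\mathsf X\subset\mathbb R^{d_x}$, and let $Y_t=f_\star(X_t)+W_t$ for $t=0,\dots,T-1$, with $X_t\in\mathsf X$, $Y_t,W_t\in\mathbb R^{d_y}$, where for some filtration $(\mathcal F_t)_{t\ge -1}$ the variable $X_t$ is $\mathcal F_{t-1}$-measurable and $(W_t)$ is a square-integrable martingale difference sequence with respect to $(\mathcal F_t)$. Let $\mathscr F$ be a class of measurable functions $\mathbb R^{d_x}\to\mathbb R^{d_y}$ with $f_\star\in\mathscr F$, and put $\mathscr F_\star=\{f-f_\star: f\in\mathscr F\}$. Let $\mathsf P_X$ be the joint law of $X_{0:T-1}$. Write $\|f\|_{L^p}^p=\frac1T\sum_{t=0}^{T-1}\mathbb E\|f(X_t)\|_2^p$, $\|f\|_\infty=\sup_{x\in\mathsf X}\|f(x)\|_2$ and $\partial B(r)=\{f\in\mathscr F_\star:\|f\|_{L^2}=r\}$. A class is star-shaped if it contains $af$ whenever it contains $f$ and $a\in[0,1]$, and $B$-bounded if $\|f\|_\infty\le B$ for all its elements. A pair $(\mathscr G,\mathsf P_X)$ is trajectory $(C,\alpha)$-hypercontractive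 if $\|f\|_{L^4}^4\le C\,(\|f\|_{L^2}^2)^{\alpha}$ for all $f\in\mathscr G$. The dependency matrix $\Gamma_{\mathsf{dep}}(\mathsf P_X)\in\mathbb R^{T\times T}$ has entries $\Gamma_{ii}=1$, $\Gamma_{ij}=0$ for $i>j$, and, for $i<j$, $$\Gamma_{ij}=\sqrt{2\sup_{A}\big\|\mathsf P_{X_{j:T-1}}(\cdot\mid A)-\mathsf P_{X_{j:T-1}}\big\|_{\mathsf{TV}}},$$ the supremum being over events $A\in\sigma(X_0,\dots,X_i)$ of positive probability, with $\|\mu-\nu\|_{\mathsf{TV}}=\sup_E|\mu(E)-\nu(E)|$; $\|\cdot\|_{\mathsf{op}}$ is the largest singular value. The martingale offset complexity is $$\mathsf M_T(\mathscr F_\star)=\sup_{f\in\mathscr F_\star}\frac1T\sum_{t=0}^{T-1}\big(4\langle W_t,f(X_t)\rangle-\|f(X_t)\|_2^2\big),$$ and $\widehat f\in\operatorname{argmin}_{f\in\mathscr F}\frac1T\sum_{t=0}^{T-1}\|Y_t-f(X_t)\|_2^2$ is a least-squares estimator. In $\|\widehat f-f_\star\|_{L^2}^2$ the norm is taken over a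 fresh independent copy of $X_{0:T-1}$, so that this is a random variable. It and $\mathsf M_T(\mathscr F_\star)$ are assumed measurable. **Theorem.** Fix $B>0$, $C:(0,B]\to(0,\infty)$, $\alpha\in[1,2]$ and $r\in(0,B]$. Suppose that $\mathscr F_\star$ is star-shaped and $B$-bounded. Let $\mathscr F_r\subset\partial B(r)$ be a finite $r/\sqrt8$-net of $\partial B(r)$ in the supremum norm $\|\cdot\|_\infty$ (every $f\in\partial B(r)$ has some $g\in\mathscr F_r$ with $\|f-g\|_\infty\le r/\sqrt8$), and suppose that $(\mathscr F_r,\mathsf P_X)$ is trajectory $(C(r),\alpha)$-hypercontractive. Then $\|\widehat f-f_\star\|_{L^2}^2$ and $\mathsf M_T(\mathscr F_\star)$ are integrable and $$\mathbb E\|\widehat f-f_\star\|_{L^2}^2\le 8\,\mathbb E\,\mathsf M_T(\mathscr F_\star)+r^2+B^2|\mathscr F_r|\exp\!\left(\frac{-T\,r^{4-2\alpha}}{8\,C(r)\,\|\Gamma_{\mathsf{dep}}(\mathsf P_X)\|_{\mathsf{op}}^2}\right).$$ -/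

import Mathlib

open MeasureTheory ProbabilityTheory
open scoped ENNReal RealInnerProductSpace

noncomputable section

/-- `ℝᵈ` with its Euclidean norm. -/
abbrev Euc (d : ℕ) : Type := EuclideanSpace ℝ (Fin d)

/-- Trajectories `x₀, …, x_{T-1}` in `ℝᵈ`. -/
abbrev Traj (T d : ℕ) : Type := Fin T → Euc d

/-- The joint law `P_X` of `X₀, …, X_{T-1}`. -/
def trajLaw {Ω : Type*} [MeasurableSpace Ω] {T d : ℕ} (μ : Measure Ω)
    (X : Fin T → Ω → Euc d) : Measure (Traj T d) :=
  μ.map (fun ω t => X t ω)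

/-- `‖f‖_{L^p}^p = (1/T) ∑_t E ‖f(X_t)‖₂^p`, where `X_{0:T-1}` has law `P`. -/
def lpPow {T dx dy : ℕ} (P : Measure (Traj T dx)) (p : ℕ) (f : Euc dx → Euc dy) : ℝ :=
  (1 / (T : ℝ)) * ∑ t : Fin T, ∫ x, ‖f (x t)‖ ^ p ∂P

/-- The supremum norm over the covariate space `S`, as an extended nonnegative number. -/
def supNormOn {dx dy : ℕ} (S : Set (Euc dx)) (f : Euc dx → Euc dy) : ℝ≥0∞ :=
  ⨆ x ∈ S, ‖f x‖ₑ

/-- A class of functions is `B`-bounded on `S`. -/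
def IsBoundedClass {dx dy : ℕ} (S : Set (Euc dx)) (G : Set (Euc dx → Euc dy)) (B : ℝ) : Prop :=
  ∀ f ∈ G, supNormOn S f ≤ ENNReal.ofReal B

/-- The shifted class `F - {fstar}`. -/
def shiftedClass {dx dy : ℕ} (F : Set (Euc dx → Euc dy)) (fstar : Euc dx → Euc dy) :
    Set (Euc dx → Euc dy) :=
  (fun f => f - fstar) '' F

/-- The elements of `G` of `L²`-norm exactly `r`, the set `∂B(r)`. -/
def l2Sphere {T dx dy : ℕ} (P : Measure (Traj T dx)) (G : Set (Euc dx → Euc dy)) (r : ℝ) :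
    Set (Euc dx → Euc dy) :=
  {f ∈ G | lpPow P 2 f = r ^ 2}

/-- `N` is a finite `ε`-net of `A` (contained in `A`) in the supremum norm over `S`. -/
def IsSupNet {dx dy : ℕ} (S : Set (Euc dx)) (N : Finset (Euc dx → Euc dy))
    (A : Set (Euc dx → Euc dy)) (ε : ℝ) : Prop :=
  (∀ g ∈ N, g ∈ A) ∧ ∀ f ∈ A, ∃ g ∈ N, supNormOn S (f - g) ≤ ENNReal.ofReal ε

/-- Trajectory `(C, α)`-hypercontractivity of `(G, P)`. -/
def TrajectoryHypercontractive {T dx dy : ℕ} (G : Set (Euc dx → Euc dy))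
    (P : Measure (Traj T dx)) (C α : ℝ) : Prop :=
  ∀ f ∈ G, lpPow P 4 f ≤ C * (lpPow P 2 f) ^ α

/-- Total variation `sup_A |μ(A) - ν(A)|` over measurable sets (for probability measures). -/
def tvNorm {E : Type*} [MeasurableSpace E] (μ ν : Measure E) : ℝ :=
  ⨆ A : {A : Set E // MeasurableSet A}, |μ.real A.1 - ν.real A.1|

/-- The `σ`-algebra on trajectories generated by the coordinates `0, …, i`. -/
abbrev pastSigma {T d : ℕ} (i : Fin T) : MeasurableSpace (Traj T d) :=
  MeasurableSpace.comap (fun (x : Traj T d) (s : Set.Iic i) => x s) inferInstance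

/-- The law of the coordinates `j, …, T-1` under `P`. -/
def futureLaw {T d : ℕ} (P : Measure (Traj T d)) (j : Fin T) :
    Measure (Set.Ici j → Euc d) :=
  P.map (fun (x : Traj T d) (s : Set.Ici j) => x s)

/-- The dependency matrix of a process with law `P`: unit diagonal, zero below the diagonal and,
for `i < j`, the square root of twice the largest total variation distance between the law of
`(Z_j, …, Z_{T-1})` and its conditional law given an event of positive probability generated
by `(Z_0, …, Z_i)`. -/
def dependencyMatrix {T d : ℕ} (P : Measure (Traj T d)) : Matrix (Fin T) (Fin T) ℝ :=
  Matrix.of fun i j =>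
    if i < j then
      √(2 * ⨆ A : {A : Set (Traj T d) // MeasurableSet[pastSigma i] A ∧ P A ≠ 0},
        tvNorm (futureLaw (P[|A.1]) j) (futureLaw P j))
    else if i = j then 1 else 0

/-- The operator norm (largest singular value) of a square real matrix. -/
def matOpNorm {T : ℕ} (M : Matrix (Fin T) (Fin T) ℝ) : ℝ :=
  ‖Matrix.toEuclideanCLM (𝕜 := ℝ) M‖

/-- The martingale offset complexity of `G` along the noise `w` and the covariates `x`. -/
def offsetComplexity {T dx dy : ℕ} (G : Set (Euc dx → Euc dy)) (w : Fin T → Euc dy)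
    (x : Fin T → Euc dx) : ℝ :=
  ⨆ f : G, (1 / (T : ℝ)) * ∑ t : Fin T, (4 * ⟪w t, f.1 (x t)⟫ - ‖f.1 (x t)‖ ^ 2)

/-- The empirical squared loss of `f` on the sample `(x_t, y_t)`. -/
def empiricalLoss {T dx dy : ℕ} (x : Fin T → Euc dx) (y : Fin T → Euc dy)
    (f : Euc dx → Euc dy) : ℝ :=
  (1 / (T : ℝ)) * ∑ t : Fin T, ‖y t - f (x t)‖ ^ 2

/-- `fhat` minimizes the empirical squared loss over `F`. -/
def IsLeastSquares {T dx dy : ℕ} (F : Set (Euc dx → Euc dy)) (x : Fin T → Euc dx)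
    (y : Fin T → Euc dy) (fhat : Euc dx → Euc dy) : Prop :=
  fhat ∈ F ∧ ∀ f ∈ F, empiricalLoss x y fhat ≤ empiricalLoss x y f

/-- The time-series regression model `Y_t = fstar(X_t) + W_t`, `0 ≤ t ≤ T-1`, with covariates in
`S`, where `X_t` is `ℱ_{t-1}`-measurable and `W` is a square integrable martingale difference
sequence with respect to the filtration `(ℱ_t)_{t ≥ -1}` (indexed by all integers). -/
structure IsRegressionModel {Ω : Type*} [mΩ : MeasurableSpace Ω] (μ : Measure Ω) {T dx dy : ℕ}
    (ℱ : Filtration ℤ mΩ) (S : Set (Euc dx)) (fstar : Euc dx → Euc dy)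
    (X : Fin T → Ω → Euc dx) (Y W : Fin T → Ω → Euc dy) : Prop where
  covariate_mem : ∀ t ω, X t ω ∈ S
  model : ∀ t ω, Y t ω = fstar (X t ω) + W t ω
  covariate_adapted : ∀ t : Fin T, Measurable[ℱ ((t : ℕ) - 1 : ℤ)] (X t)
  noise_adapted : ∀ t : Fin T, Measurable[ℱ ((t : ℕ) : ℤ)] (W t)
  noise_sq_integrable : ∀ t, MemLp (W t) 2 μ
  noise_mds : ∀ t : Fin T, μ[W t | ℱ ((t : ℕ) - 1 : ℤ)] =ᵐ[μ] 0

end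

/-!
The bound is a deterministic argument on the event that every function of the class of `L²`-norm
larger than `r` has a comparably large empirical norm, plus a tail estimate for that event.

*Deterministic part.* The least squares estimator satisfies the basic inequality
`empSq x (fhat - fstar) ≤ offsetComplexity` (`empSq_le_offsetComplexity`). If every `g` in the net
has empirical square above `r ^ 2 / 2`, then by approximation every `f` on the sphere of radius
`r` has empirical square at least `r ^ 2 / 8`, and star-shapedness carries this to all `f` outside
the ball (`lpPow_le_of_forall_net`). So the risk is at most `r ^ 2` or at most eight times the
offset complexity; on the complementary event it is at most `B ^ 2`.

*Probabilistic part.* For one `g` of the net the failure probability is bounded by Chernoff's method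
and Samson's inequality (`integral_exp_neg_sum_le`)
`E exp (-l Z) ≤ exp (-l E Z + l² ‖Γ‖² V / 2)`, where `Z = ∑ g_t(X_t)` with `g_t ≥ 0` and
`V = ∑ E g_t(X_t)²`; hypercontractivity controls `V`. Samson's inequality follows, by the
variational formula for the entropy of the density `h = exp (-l Z)`, from the transport-entropy
inequality `sum_integral_mul_sub_le_entropy`. The latter is proved without couplings. Let `M i` be
the conditional mean of `h` given the first `i` observations, and measure the distance between
densities by the one-sided chi-square divergence `chiDiv`, that is `∫ (a - b)₊² / a`.
* The divergences of consecutive `M i` add up to at most twice the entropy of `h`, by the chain rule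
  and a pointwise inequality (`chiDiv_le_entropy_step`).
* Projecting `M i` and `M (i + 1)` on the `j`-th observation multiplies the divergence by at most the
  squared entry `(i, j)` of the dependency matrix (`integral_mul_sub_le_of_mixing`,
  `chiDiv_condMean_le`).
* The integrand of the square root of the divergence satisfies a pointwise triangle inequality
  (`posPart_div_sqrt_triangle`), so for each `j` the projected divergences from the constant density
  to `h` can be added over `i`. Summing over `j` produces the operator norm of the matrix.
-/

/-! ### Bounded measurable functions and bounded conditional means -/

/-- A real function that is measurable with respect to `m` and bounded everywhere. -/
structure BddMeasurable {Ω : Type*} (m : MeasurableSpace Ω) (f : Ω → ℝ) : Prop where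
  measurable : Measurable[m] f
  bounded : ∃ D, ∀ ω, |f ω| ≤ D

namespace BddMeasurable

variable {Ω : Type*} {m m' m0 : MeasurableSpace Ω} {f g : Ω → ℝ}

theorem const (c : ℝ) : BddMeasurable m (fun _ => c) :=
  ⟨measurable_const, |c|, fun _ => le_rfl⟩

theorem mono (hf : BddMeasurable m f) (h : m ≤ m') : BddMeasurable m' f :=
  ⟨hf.measurable.mono h le_rfl, hf.bounded⟩

theorem of_mem_Icc (hf : Measurable[m] f) {c d : ℝ} (h : ∀ ω, f ω ∈ Set.Icc c d) :
    BddMeasurable m f :=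
  ⟨hf, max |c| |d|, fun ω => abs_le_max_abs_abs (h ω).1 (h ω).2⟩

theorem add (hf : BddMeasurable m f) (hg : BddMeasurable m g) :
    BddMeasurable m (fun ω => f ω + g ω) := by
  obtain ⟨hf, D, hD⟩ := hf
  obtain ⟨hg, E, hE⟩ := hg
  exact ⟨hf.add hg, D + E, fun ω => (abs_add_le _ _).trans (add_le_add (hD ω) (hE ω))⟩

theorem mul (hf : BddMeasurable m f) (hg : BddMeasurable m g) :
    BddMeasurable m (fun ω => f ω * g ω) := by
  obtain ⟨hf, D, hD⟩ := hf
  obtain ⟨hg, E, hE⟩ := hg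
  refine ⟨hf.mul hg, D * E, fun ω => ?_⟩
  rw [abs_mul]
  exact mul_le_mul (hD ω) (hE ω) (abs_nonneg _) ((abs_nonneg _).trans (hD ω))

theorem sub (hf : BddMeasurable m f) (hg : BddMeasurable m g) :
    BddMeasurable m (fun ω => f ω - g ω) := by
  simpa [sub_eq_add_neg] using hf.add ((const (-1)).mul hg)

theorem sq (hf : BddMeasurable m f) : BddMeasurable m (fun ω => f ω ^ 2) := by
  simpa [pow_two] using hf.mul hf

theorem max_zero (hf : BddMeasurable m f) : BddMeasurable m (fun ω => max (f ω) 0) := by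
  obtain ⟨hf, D, hD⟩ := hf
  exact ⟨hf.max measurable_const, D, fun ω =>
    (abs_of_nonneg (le_max_right _ _)).le.trans
      (max_le ((le_abs_self _).trans (hD ω)) ((abs_nonneg _).trans (hD ω)))⟩

theorem inv (hf : Measurable[m] f) {c : ℝ} (hc : 0 < c) (h : ∀ ω, c ≤ f ω) :
    BddMeasurable m (fun ω => (f ω)⁻¹) :=
  of_mem_Icc (c := 0) (d := c⁻¹) hf.inv fun ω =>
    ⟨inv_nonneg.2 (hc.le.trans (h ω)), inv_anti₀ hc (h ω)⟩

theorem sqrt (hf : BddMeasurable m f) : BddMeasurable m (fun ω => √(f ω)) := by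
  obtain ⟨hf, D, hD⟩ := hf
  exact of_mem_Icc (c := 0) (d := √D) (Real.continuous_sqrt.measurable.comp hf) fun ω =>
    ⟨Real.sqrt_nonneg _, Real.sqrt_le_sqrt ((le_abs_self _).trans (hD ω))⟩

theorem log (hf : BddMeasurable m f) {c : ℝ} (hc : 0 < c) (h : ∀ ω, c ≤ f ω) :
    BddMeasurable m (fun ω => Real.log (f ω)) := by
  obtain ⟨hf, D, hD⟩ := hf
  exact of_mem_Icc (c := Real.log c) (d := Real.log D) (Real.measurable_log.comp hf) fun ω =>
    ⟨Real.log_le_log hc (h ω),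
      Real.log_le_log (hc.trans_le (h ω)) ((le_abs_self _).trans (hD ω))⟩

theorem div (hf : BddMeasurable m f) (hg : Measurable[m] g) {c : ℝ} (hc : 0 < c)
    (h : ∀ ω, c ≤ g ω) : BddMeasurable m (fun ω => f ω / g ω) := by
  simpa [div_eq_mul_inv] using hf.mul (inv hg hc h)

theorem sum {ι : Type*} {s : Finset ι} {F : ι → Ω → ℝ} (h : ∀ i ∈ s, BddMeasurable m (F i)) :
    BddMeasurable m (fun ω => ∑ i ∈ s, F i ω) := by
  classical
  induction s using Finset.induction_on with
  | empty => simpa using const (m := m) 0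
  | insert a s ha ih =>
    simp only [Finset.sum_insert ha]
    exact (h _ (Finset.mem_insert_self _ _)).add
      (ih fun i hi => h i (Finset.mem_insert_of_mem hi))

theorem indicator_one {s : Set Ω} (hs : MeasurableSet[m] s) :
    BddMeasurable m (s.indicator fun _ => (1 : ℝ)) :=
  of_mem_Icc (c := 0) (d := 1) (measurable_const.indicator hs) fun ω => by
    by_cases h : ω ∈ s <;> simp [h]

theorem integrable (hf : BddMeasurable m f) (hm : m ≤ m0) (P : @Measure Ω m0)
    [IsFiniteMeasure P] : Integrable f P := by
  obtain ⟨hf, D, hD⟩ := hf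
  exact Integrable.of_bound (hf.mono hm le_rfl).aestronglyMeasurable D (.of_forall hD)

end BddMeasurable

/-- `M` represents the conditional mean of `h` given `m`, tested against bounded functions. -/
def IsCondMean {Ω : Type*} {m0 : MeasurableSpace Ω} (P : Measure Ω) (m : MeasurableSpace Ω)
    (h M : Ω → ℝ) : Prop :=
  ∀ ζ, BddMeasurable m ζ → ∫ ω, ζ ω * M ω ∂P = ∫ ω, ζ ω * h ω ∂P

/-- Truncating the conditional expectation gives a version respecting the bounds everywhere, not
just almost surely. -/
theorem exists_isCondMean {Ω : Type*} {m m0 : MeasurableSpace Ω} (hm : m ≤ m0) (P : Measure Ω)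
    [IsFiniteMeasure P] {h : Ω → ℝ} (hh : Measurable h) {c d : ℝ}
    (hcd : ∀ ω, h ω ∈ Set.Icc c d) :
    ∃ M : Ω → ℝ, Measurable[m] M ∧ (∀ ω, M ω ∈ Set.Icc c d) ∧ IsCondMean P m h M := by
  have hbm : BddMeasurable m0 h := .of_mem_Icc hh hcd
  have hint : Integrable h P := hbm.integrable le_rfl P
  refine ⟨fun ω => max c (min d (P[h|m] ω)), ?_, ?_, ?_⟩
  · exact measurable_const.max (measurable_const.min stronglyMeasurable_condExp.measurable)
  · exact fun ω => ⟨le_max_left _ _, max_le ((hcd ω).1.trans (hcd ω).2) (min_le_left _ _)⟩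
  · intro ζ hζ
    have h1 : ∀ᵐ ω ∂P, c ≤ P[h|m] ω := by
      have := condExp_mono (m := m) (integrable_const (μ := P) c) hint
        (.of_forall fun ω => (hcd ω).1)
      rwa [condExp_const hm] at this
    have h2 : ∀ᵐ ω ∂P, P[h|m] ω ≤ d := by
      have := condExp_mono (m := m) hint (integrable_const (μ := P) d)
        (.of_forall fun ω => (hcd ω).2)
      rwa [condExp_const hm] at this
    obtain ⟨D, hD⟩ := hζ.bounded
    have h3 := condExp_stronglyMeasurable_mul_of_bound hm (μ := P) (f := ζ)
      hζ.measurable.stronglyMeasurable hint D (.of_forall hD)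
    calc ∫ ω, ζ ω * max c (min d (P[h|m] ω)) ∂P = ∫ ω, (P[ζ * h|m]) ω ∂P := by
          refine integral_congr_ae ?_
          filter_upwards [h1, h2, h3] with ω a1 a2 a3
          rw [a3, min_eq_right a2, max_eq_right a1]; rfl
      _ = ∫ ω, ζ ω * h ω ∂P := integral_condExp hm

/-! ### The one-sided chi-square divergence -/

theorem log_le_half_sub_inv {x : ℝ} (hx : 1 ≤ x) : Real.log x ≤ (x - x⁻¹) / 2 := by
  rw [← Real.sinh_log (by linarith)]
  exact Real.self_le_sinh_iff.2 (Real.log_nonneg hx)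

/-- The Bregman divergence of `u ↦ u log u` dominates the one-sided chi-square divergence. -/
theorem posPart_sq_div_le_bregman {u v : ℝ} (hu : 0 < u) (hv : 0 < v) :
    max (v - u) 0 ^ 2 / v ≤
      2 * (u * Real.log u - v * Real.log v - (1 + Real.log v) * (u - v)) := by
  have key : u * Real.log u - v * Real.log v - (1 + Real.log v) * (u - v)
      = u * (Real.log u - Real.log v) - u + v := by ring
  rw [key]
  rcases le_total u v with h | h
  · have h1 := log_le_half_sub_inv ((one_le_div hu).2 h)
    rw [Real.log_div hv.ne' hu.ne', inv_div] at h1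
    have h2 : u * (Real.log v - Real.log u) ≤ (v - u ^ 2 / v) / 2 := by
      refine (mul_le_mul_of_nonneg_left h1 hu.le).trans (le_of_eq ?_)
      field_simp
    rw [max_eq_left (by linarith)]
    have h3 : (v - u) ^ 2 / v = v - 2 * u + u ^ 2 / v := by field_simp; ring
    rw [h3]; linarith
  · rw [max_eq_right (by linarith)]
    have h1 := Real.log_le_sub_one_of_pos (div_pos hv hu)
    rw [Real.log_div hv.ne' hu.ne'] at h1
    have h2 : u * (Real.log v - Real.log u) ≤ v - u := by
      refine (mul_le_mul_of_nonneg_left h1 hu.le).trans (le_of_eq ?_)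
      field_simp
    simp; linarith

/-- A pointwise triangle inequality for the square root of the one-sided chi-square integrand;
it rests on the monotonicity of `b ↦ (b - c) / √b`. -/
theorem posPart_div_sqrt_triangle {a b c : ℝ} (ha : 0 < a) (hb : 0 < b) (hc : 0 < c) :
    max (a - c) 0 / √a ≤ max (a - b) 0 / √a + max (b - c) 0 / √b := by
  have sa := Real.sqrt_pos.2 ha
  have sb := Real.sqrt_pos.2 hb
  rcases le_total a c with hac | hac
  · rw [max_eq_right (by linarith)]; simp; positivity
  rw [max_eq_left (by linarith)]
  rcases le_total a b with hab | hab
  · have : (a - c) / √a ≤ (b - c) / √b := by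
      rw [div_le_div_iff₀ sa sb]
      have e1 : a = √a ^ 2 := (Real.sq_sqrt ha.le).symm
      have e2 : b = √b ^ 2 := (Real.sq_sqrt hb.le).symm
      have e3 : √a ≤ √b := Real.sqrt_le_sqrt hab
      have e4 : (b - c) * √a - (a - c) * √b = (√b - √a) * (√a * √b + c) := by
        linear_combination √a * e2 - √b * e1
      nlinarith [mul_nonneg (sub_nonneg.2 e3) (by positivity : 0 ≤ √a * √b + c)]
    calc (a - c) / √a ≤ (b - c) / √b := this
      _ ≤ max (b - c) 0 / √b := by gcongr; exact le_max_left _ _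
      _ ≤ _ := le_add_of_nonneg_left (by positivity)
  · have h1 : (b - c) / √a ≤ max (b - c) 0 / √b :=
      calc (b - c) / √a ≤ max (b - c) 0 / √a := by gcongr; exact le_max_left _ _
        _ ≤ max (b - c) 0 / √b := by gcongr
    rw [max_eq_left (by linarith : 0 ≤ a - b)]
    have : (a - c) / √a = (a - b) / √a + (b - c) / √a := by ring
    linarith

theorem posPart_div_sqrt_le_sum {b : ℕ → ℝ} (hb : ∀ i, 0 < b i) (n : ℕ) :
    max (b 0 - b n) 0 / √(b 0) ≤
      ∑ i ∈ Finset.range n, max (b i - b (i + 1)) 0 / √(b i) := by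
  induction n with
  | zero => simp
  | succ n ih =>
    rw [Finset.sum_range_succ]
    exact (posPart_div_sqrt_triangle (hb 0) (hb n) (hb (n + 1))).trans (by gcongr)

/-- The one-sided chi-square divergence `∫ (a - b)₊² / a` between densities `a` and `b`. -/
noncomputable def chiDiv {Ω : Type*} {m0 : MeasurableSpace Ω} (P : Measure Ω) (a b : Ω → ℝ) : ℝ :=
  ∫ ω, max (a ω - b ω) 0 ^ 2 / a ω ∂P

theorem chiDiv_nonneg {Ω : Type*} {m0 : MeasurableSpace Ω} {P : Measure Ω} {a b : Ω → ℝ}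
    (ha : ∀ ω, 0 ≤ a ω) : 0 ≤ chiDiv P a b :=
  integral_nonneg fun ω => div_nonneg (sq_nonneg _) (ha ω)

section

variable {Ω : Type*} {m m0 : MeasurableSpace Ω} {P : Measure Ω} [IsFiniteMeasure P]

/-- One step of the chain rule for the entropy. -/
theorem chiDiv_le_entropy_step (hm : m ≤ m0) {M M' : Ω → ℝ} {c : ℝ} (hc : 0 < c)
    (hM : BddMeasurable m M) (hM' : BddMeasurable m0 M') (hcM : ∀ ω, c ≤ M ω)
    (hcM' : ∀ ω, c ≤ M' ω) (hcond : IsCondMean P m M' M) :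
    chiDiv P M M' ≤
      2 * (∫ ω, M' ω * Real.log (M' ω) ∂P - ∫ ω, M ω * Real.log (M ω) ∂P) := by
  have hM0 := hM.mono hm
  have hζ : BddMeasurable m (fun ω => 1 + Real.log (M ω)) :=
    (BddMeasurable.const 1).add (hM.log hc hcM)
  have hζ0 := hζ.mono hm
  have i1 := (hM'.mul (hM'.log hc hcM')).integrable le_rfl P
  have i2 := (hM0.mul (hM0.log hc hcM)).integrable le_rfl P
  have i3 := (hζ0.mul (hM'.sub hM0)).integrable le_rfl P
  have e : ∫ ω, (1 + Real.log (M ω)) * (M' ω - M ω) ∂P = 0 := by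
    simp_rw [mul_sub]
    rw [integral_sub ((hζ0.mul hM').integrable le_rfl P) ((hζ0.mul hM0).integrable le_rfl P),
      hcond _ hζ, sub_self]
  calc chiDiv P M M' ≤ ∫ ω, 2 * (M' ω * Real.log (M' ω) - M ω * Real.log (M ω)
          - (1 + Real.log (M ω)) * (M' ω - M ω)) ∂P := by
        refine integral_mono ?_ (((i1.sub i2).sub i3).const_mul 2) fun ω =>
          posPart_sq_div_le_bregman (hc.trans_le (hcM' ω)) (hc.trans_le (hcM ω))
        exact ((hM0.sub hM').max_zero.sq.div hM0.measurable hc hcM).integrable le_rfl P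
    _ = _ := by
        rw [integral_const_mul, integral_sub (by exact i1.sub i2) i3, integral_sub i1 i2, e,
          sub_zero]

theorem integral_mul_le_sqrt_mul_sqrt {f g : Ω → ℝ} (hf : BddMeasurable m0 f)
    (hg : BddMeasurable m0 g) (hf0 : ∀ ω, 0 ≤ f ω) (hg0 : ∀ ω, 0 ≤ g ω) :
    ∫ ω, f ω * g ω ∂P ≤ √(∫ ω, f ω ^ 2 ∂P) * √(∫ ω, g ω ^ 2 ∂P) := by
  have hp : (2 : ℝ).HolderConjugate 2 := Real.HolderConjugate.two_two
  have hL : ∀ {f : Ω → ℝ}, BddMeasurable m0 f → MemLp f (ENNReal.ofReal 2) P := fun {f} hf => by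
    obtain ⟨hf, D, hD⟩ := hf
    exact MemLp.of_bound hf.aestronglyMeasurable D (.of_forall hD)
  have := integral_mul_le_Lp_mul_Lq_of_nonneg (μ := P) hp (.of_forall hf0) (.of_forall hg0)
    (hL hf) (hL hg)
  simpa [Real.sqrt_eq_rpow] using this

/-- Passing to the conditional means given `𝒮` can only shrink the divergence, by the factor by
which `𝒮`-measurable test functions are insensitive to the change from `M` to `M'`. -/
theorem chiDiv_condMean_le {𝒮 : MeasurableSpace Ω} (h𝒮 : 𝒮 ≤ m0) {M M' b b' : Ω → ℝ} {c : ℝ}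
    (hc : 0 < c) (hM : BddMeasurable m0 M) (hM' : BddMeasurable m0 M')
    (hb : BddMeasurable 𝒮 b) (hb' : BddMeasurable 𝒮 b') (hcb : ∀ ω, c ≤ b ω)
    (hbM : IsCondMean P 𝒮 M b) (hbM' : IsCondMean P 𝒮 M' b') {γ : ℝ}
    (hmix : ∀ φ, BddMeasurable 𝒮 φ → (∀ ω, 0 ≤ φ ω) →
      ∫ ω, φ ω * (M ω - M' ω) ∂P ≤
        (∫ ω, M ω * φ ω ^ 2 ∂P) / 2 + γ * chiDiv P M M' / 2) :
    chiDiv P b b' ≤ γ * chiDiv P M M' := by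
  set φ : Ω → ℝ := fun ω => max (b ω - b' ω) 0 / b ω with hφdef
  have hφ : BddMeasurable 𝒮 φ := (hb.sub hb').max_zero.div hb.measurable hc hcb
  have hφ0 := hφ.mono h𝒮
  have hb0 : ∀ ω, 0 < b ω := fun ω => hc.trans_le (hcb ω)
  have e1 : ∫ ω, φ ω * (M ω - M' ω) ∂P = chiDiv P b b' := by
    simp_rw [mul_sub]
    rw [integral_sub ((hφ0.mul hM).integrable le_rfl P) ((hφ0.mul hM').integrable le_rfl P),
      ← hbM _ hφ, ← hbM' _ hφ, ← integral_sub ((hφ.mul hb).integrable h𝒮 P)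
        ((hφ.mul hb').integrable h𝒮 P)]
    refine integral_congr_ae (.of_forall fun ω => ?_)
    simp only [hφdef]
    rcases le_total (b ω) (b' ω) with h | h
    · simp [max_eq_right (sub_nonpos.2 h)]
    · rw [max_eq_left (sub_nonneg.2 h)]; ring
  have e2 : ∫ ω, M ω * φ ω ^ 2 ∂P = chiDiv P b b' := by
    simp_rw [mul_comm (M _)]
    rw [← hbM _ hφ.sq]
    refine integral_congr_ae (.of_forall fun ω => ?_)
    have := (hb0 ω).ne'
    simp only [hφdef]; field_simp
  have := hmix φ hφ fun ω => div_nonneg (le_max_right _ _) (hb0 ω).le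
  rw [e1, e2] at this
  linarith

/-- Without any mixing the factor is one. -/
theorem integral_mul_sub_le_chiDiv {M M' : Ω → ℝ} {c : ℝ} (hc : 0 < c) (hM : BddMeasurable m0 M)
    (hM' : BddMeasurable m0 M') (hcM : ∀ ω, c ≤ M ω) {φ : Ω → ℝ} (hφ : BddMeasurable m0 φ)
    (hφ0 : ∀ ω, 0 ≤ φ ω) :
    ∫ ω, φ ω * (M ω - M' ω) ∂P ≤ (∫ ω, M ω * φ ω ^ 2 ∂P) / 2 + chiDiv P M M' / 2 := by
  have i1 := (hM.mul hφ.sq).integrable le_rfl P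
  have i2 := ((hM.sub hM').max_zero.sq.div hM.measurable hc hcM).integrable le_rfl P
  rw [chiDiv, ← integral_div, ← integral_div, ← integral_add (i1.div_const 2) (i2.div_const 2)]
  refine integral_mono ((hφ.mul (hM.sub hM')).integrable le_rfl P)
    ((i1.div_const 2).add (i2.div_const 2)) fun ω => ?_
  have hp : 0 < M ω := hc.trans_le (hcM ω)
  set v := max (M ω - M' ω) 0
  have h1 : φ ω * (M ω - M' ω) ≤ φ ω * v := mul_le_mul_of_nonneg_left (le_max_left _ _) (hφ0 ω)
  have h2 : M ω * φ ω ^ 2 / 2 + v ^ 2 / M ω / 2 - φ ω * v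
      = (M ω * φ ω - v) ^ 2 / (2 * M ω) := by field_simp; ring
  have h3 : 0 ≤ (M ω * φ ω - v) ^ 2 / (2 * M ω) := by positivity
  change φ ω * (M ω - M' ω) ≤ M ω * φ ω ^ 2 / 2 + v ^ 2 / M ω / 2
  linarith

/-- A nonnegative function has a small increment along a chain of densities whose consecutive
divergences are small. -/
theorem integral_mul_sub_le_sum_chiDiv {b : ℕ → Ω → ℝ} {c : ℝ} (hc : 0 < c)
    (hb : ∀ i, BddMeasurable m0 (b i)) (hcb : ∀ i ω, c ≤ b i ω) {g : Ω → ℝ}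
    (hg : BddMeasurable m0 g) (hg0 : ∀ ω, 0 ≤ g ω) (n : ℕ) :
    ∫ ω, g ω * (b 0 ω - b n ω) ∂P ≤
      √(∫ ω, g ω ^ 2 * b 0 ω ∂P) *
        ∑ i ∈ Finset.range n, √(chiDiv P (b i) (b (i + 1))) := by
  have hpos : ∀ i ω, 0 < b i ω := fun i ω => hc.trans_le (hcb i ω)
  have hsq : ∀ i ω, √c ≤ √(b i ω) := fun i ω => Real.sqrt_le_sqrt (hcb i ω)
  have hw : ∀ i, BddMeasurable m0 (fun ω => max (b i ω - b (i + 1) ω) 0 / √(b i ω)) := fun i =>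
    ((hb i).sub (hb (i + 1))).max_zero.div (hb i).sqrt.measurable (Real.sqrt_pos.2 hc) (hsq i)
  have hgs : BddMeasurable m0 (fun ω => g ω * √(b 0 ω)) := hg.mul (hb 0).sqrt
  calc ∫ ω, g ω * (b 0 ω - b n ω) ∂P
      ≤ ∫ ω, ∑ i ∈ Finset.range n,
          (g ω * √(b 0 ω)) * (max (b i ω - b (i + 1) ω) 0 / √(b i ω)) ∂P := by
        refine integral_mono ((hg.mul ((hb 0).sub (hb n))).integrable le_rfl P)
          ((BddMeasurable.sum fun i _ => hgs.mul (hw i)).integrable le_rfl P) fun ω => ?_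
        have h1 := posPart_div_sqrt_le_sum (fun i => hpos i ω) n
        have h2 : b 0 ω - b n ω ≤ √(b 0 ω) * (max (b 0 ω - b n ω) 0 / √(b 0 ω)) := by
          rw [mul_div_cancel₀ _ (Real.sqrt_pos.2 (hpos 0 ω)).ne']; exact le_max_left _ _
        calc g ω * (b 0 ω - b n ω)
            ≤ g ω * (√(b 0 ω) * (max (b 0 ω - b n ω) 0 / √(b 0 ω))) :=
              mul_le_mul_of_nonneg_left h2 (hg0 ω)
          _ ≤ g ω * (√(b 0 ω) * ∑ i ∈ Finset.range n,
                max (b i ω - b (i + 1) ω) 0 / √(b i ω)) := by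
              have := hg0 ω
              gcongr
          _ = _ := by rw [← mul_assoc, Finset.mul_sum]
    _ = ∑ i ∈ Finset.range n,
          ∫ ω, (g ω * √(b 0 ω)) * (max (b i ω - b (i + 1) ω) 0 / √(b i ω)) ∂P :=
        integral_finsetSum _ fun i _ => (hgs.mul (hw i)).integrable le_rfl P
    _ ≤ ∑ i ∈ Finset.range n,
          √(∫ ω, g ω ^ 2 * b 0 ω ∂P) * √(chiDiv P (b i) (b (i + 1))) := by
        refine Finset.sum_le_sum fun i _ => ?_
        refine (integral_mul_le_sqrt_mul_sqrt hgs (hw i)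
          (fun ω => mul_nonneg (hg0 ω) (Real.sqrt_nonneg _))
          fun ω => div_nonneg (le_max_right _ _) (Real.sqrt_nonneg _)).trans (le_of_eq ?_)
        simp only [mul_pow, div_pow, Real.sq_sqrt (hpos _ _).le, chiDiv]
    _ = _ := (Finset.mul_sum _ _ _).symm

end

/-! ### Mixing in total variation -/

/-- The linearized form of
`∫ φ dν' - ∫ φ dν ≤ √(γ ∫ φ² dν')` when `ν'` exceeds `ν` by at most `γ` on every set. -/
theorem integral_sub_integral_le_of_tv {E : Type*} [mE : MeasurableSpace E] (ν' ν : Measure E)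
    [IsFiniteMeasure ν'] [IsFiniteMeasure ν] {γ : ℝ}
    (hγ : ∀ s, MeasurableSet s → ν'.real s - ν.real s ≤ γ) {φ : E → ℝ}
    (hφ : BddMeasurable mE φ) (hφ0 : ∀ x, 0 ≤ φ x) {q : ℝ} (hq : 0 < q) :
    ∫ x, φ x ∂ν' - ∫ x, φ x ∂ν ≤ q / 2 * ∫ x, φ x ^ 2 ∂ν' + γ / (2 * q) := by
  obtain ⟨s, hs, hs1, hs2⟩ := hahn_decomposition ν' ν
  have r1 : ν.restrict s ≤ ν'.restrict s := Measure.le_iff.2 fun t ht => by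
    rw [Measure.restrict_apply ht, Measure.restrict_apply ht]
    exact hs1 _ (ht.inter hs) Set.inter_subset_right
  have r2 : ν'.restrict sᶜ ≤ ν.restrict sᶜ := Measure.le_iff.2 fun t ht => by
    rw [Measure.restrict_apply ht, Measure.restrict_apply ht]
    exact hs2 _ (ht.inter hs.compl) Set.inter_subset_right
  have iφ : ∀ ρ : Measure E, IsFiniteMeasure ρ → Integrable φ ρ := fun ρ _ =>
    hφ.integrable le_rfl ρ
  have iφ2 : ∀ ρ : Measure E, IsFiniteMeasure ρ → Integrable (fun x => φ x ^ 2) ρ := fun ρ _ =>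
    hφ.sq.integrable le_rfl ρ
  have d1 := integral_add_compl hs (iφ ν' inferInstance)
  have d2 := integral_add_compl hs (iφ ν inferInstance)
  have d3 := integral_add_compl hs (iφ2 ν' inferInstance)
  have n3 : 0 ≤ ∫ x in sᶜ, φ x ^ 2 ∂ν' := integral_nonneg fun x => sq_nonneg _
  have n4 : 0 ≤ ∫ x in s, φ x ^ 2 ∂ν := integral_nonneg fun x => sq_nonneg _
  have c1 : ∫ x in sᶜ, φ x ∂ν' ≤ ∫ x in sᶜ, φ x ∂ν :=
    integral_mono_measure r2 (.of_forall hφ0) (iφ _ inferInstance)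
  have iψ : ∀ ρ : Measure E, IsFiniteMeasure ρ →
      Integrable (fun x => q / 2 * φ x ^ 2 + 1 / (2 * q) - φ x) ρ := fun ρ _ =>
    (((iφ2 ρ inferInstance).const_mul _).add (integrable_const _)).sub (iφ ρ inferInstance)
  have c2 : ∫ x in s, (q / 2 * φ x ^ 2 + 1 / (2 * q) - φ x) ∂ν ≤
      ∫ x in s, (q / 2 * φ x ^ 2 + 1 / (2 * q) - φ x) ∂ν' := by
    refine integral_mono_measure r1 (.of_forall fun x => ?_) (iψ _ inferInstance)
    have : q / 2 * φ x ^ 2 + 1 / (2 * q) - φ x = (q * φ x - 1) ^ 2 / (2 * q) := by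
      field_simp; ring
    simp only [Pi.zero_apply, this]
    positivity
  have ev : ∀ ρ : Measure E, IsFiniteMeasure ρ →
      ∫ x in s, (q / 2 * φ x ^ 2 + 1 / (2 * q) - φ x) ∂ρ =
        q / 2 * ∫ x in s, φ x ^ 2 ∂ρ + ρ.real s * (1 / (2 * q)) - ∫ x in s, φ x ∂ρ := by
    intro ρ _
    rw [integral_sub (by exact ((iφ2 _ inferInstance).const_mul _).add (integrable_const _))
      (iφ _ inferInstance), integral_add ((iφ2 _ inferInstance).const_mul _) (integrable_const _),
      integral_const_mul]
    simp
  rw [ev _ inferInstance, ev _ inferInstance] at c2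
  have hγs := mul_le_mul_of_nonneg_right (hγ s hs) (by positivity : 0 ≤ 1 / (2 * q))
  have e1 : γ * (1 / (2 * q)) = γ / (2 * q) := by ring
  have hq2 : 0 ≤ q / 2 := by positivity
  have := mul_nonneg hq2 n3
  have := mul_nonneg hq2 n4
  rw [← d1, ← d2, ← d3, mul_add]
  linarith

section

variable {Ω : Type*} {m m0 : MeasurableSpace Ω} {P : Measure Ω}

theorem ae_le_of_setIntegral_le [IsFiniteMeasure P] (hm : m ≤ m0) {f g : Ω → ℝ}
    (hf : BddMeasurable m f) (hg : BddMeasurable m g)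
    (h : ∀ A, MeasurableSet[m] A → P A ≠ 0 → ∫ ω in A, f ω ∂P ≤ ∫ ω in A, g ω ∂P) :
    ∀ᵐ ω ∂P, f ω ≤ g ω := by
  refine ae_of_ae_trim hm (ae_le_of_forall_setIntegral_le (hf.integrable le_rfl _)
    (hg.integrable le_rfl _) fun A hA _ => ?_)
  rw [← setIntegral_trim hm hf.measurable.stronglyMeasurable hA,
    ← setIntegral_trim hm hg.measurable.stronglyMeasurable hA]
  by_cases h0 : P A = 0
  · simp [Measure.restrict_eq_zero.2 h0]
  · exact h A hA h0

theorem IsCondMean.setIntegral (hm : m ≤ m0) {h M : Ω → ℝ} (hM : IsCondMean P m h M) {A : Set Ω}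
    (hA : MeasurableSet[m] A) : ∫ ω in A, M ω ∂P = ∫ ω in A, h ω ∂P := by
  have := hM _ (BddMeasurable.indicator_one hA)
  have e : ∀ f : Ω → ℝ, ∫ ω, A.indicator (fun _ => (1 : ℝ)) ω * f ω ∂P = ∫ ω in A, f ω ∂P := by
    intro f
    rw [← integral_indicator (hm _ hA)]
    refine integral_congr_ae (.of_forall fun ω => ?_)
    by_cases hω : ω ∈ A <;> simp [hω]
  rwa [e, e] at this

theorem IsCondMean.integral_eq {h M : Ω → ℝ} (hM : IsCondMean P m h M) :
    ∫ ω, M ω ∂P = ∫ ω, h ω ∂P := by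
  simpa using hM _ (BddMeasurable.const 1)

theorem setIntegral_eq_mul_integral_cond [IsFiniteMeasure P] {A : Set Ω}
    (h0 : P A ≠ 0) (f : Ω → ℝ) : ∫ ω in A, f ω ∂P = P.real A * ∫ ω, f ω ∂P[|A] := by
  have h1 : P.real A ≠ 0 := (measureReal_ne_zero_iff (measure_ne_top P A)).2 h0
  rw [ProbabilityTheory.cond, integral_smul_measure, ENNReal.toReal_inv, smul_eq_mul,
    ← mul_assoc, ← Measure.real, mul_inv_cancel₀ h1, one_mul]

theorem two_mul_le_of_forall_rat {k K₂ γ : ℝ} (hk : 0 ≤ k) (hK₂ : 0 ≤ K₂) (hγ : 0 ≤ γ)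
    (h : ∀ q : ℚ, 0 < q → k ≤ q / 2 * K₂ + γ / (2 * q)) (x : ℝ) :
    2 * x * k ≤ x ^ 2 * K₂ + γ := by
  refine Rat.denseRange_cast.induction_on (p := fun x : ℝ => 2 * x * k ≤ x ^ 2 * K₂ + γ) x
    (isClosed_le (by fun_prop) (by fun_prop)) fun q => ?_
  rcases le_or_gt q 0 with hq | hq
  · have h1 : (q : ℝ) ≤ 0 := by exact_mod_cast hq
    nlinarith [mul_nonneg (neg_nonneg.2 h1) hk, mul_nonneg (sq_nonneg (q : ℝ)) hK₂]
  · have h1 : (0 : ℝ) < q := by exact_mod_cast hq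
    have h2 := mul_le_mul_of_nonneg_left (h q hq) (by positivity : (0 : ℝ) ≤ 2 * q)
    calc 2 * (q : ℝ) * k ≤ 2 * q * (q / 2 * K₂ + γ / (2 * q)) := h2
      _ = (q : ℝ) ^ 2 * K₂ + γ := by field_simp

/-- If conditioning on events of `m` moves the law on `𝒮` by at most `γ` in total variation, then
`𝒮`-measurable test functions are insensitive to the change of an `m`-measurable density. -/
theorem integral_mul_sub_le_of_mixing [IsProbabilityMeasure P] (hm : m ≤ m0)
    {𝒮 : MeasurableSpace Ω} (h𝒮 : 𝒮 ≤ m0) {γ : ℝ} (hγ0 : 0 ≤ γ)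
    (hγ : ∀ A A', MeasurableSet[m] A → MeasurableSet[m] A' → P A ≠ 0 → P A' ≠ 0 →
      ∀ E, MeasurableSet[𝒮] E → (P[|A']).real E - (P[|A]).real E ≤ γ)
    {M M' : Ω → ℝ} {c : ℝ} (hc : 0 < c) (hM : BddMeasurable m M) (hM' : BddMeasurable m M')
    (hcM : ∀ ω, c ≤ M ω) (hMM' : ∫ ω, M ω ∂P = ∫ ω, M' ω ∂P)
    {φ : Ω → ℝ} (hφ : BddMeasurable 𝒮 φ) (hφ0 : ∀ ω, 0 ≤ φ ω) :
    ∫ ω, φ ω * (M ω - M' ω) ∂P ≤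
      (∫ ω, M ω * φ ω ^ 2 ∂P) / 2 + γ * chiDiv P M M' / 2 := by
  obtain ⟨D, hD⟩ := hφ.bounded
  have hφm := hφ.mono h𝒮
  obtain ⟨K, hKm, hKb, hK⟩ := exists_isCondMean hm P hφm.measurable (c := 0) (d := D)
    fun ω => ⟨hφ0 ω, (le_abs_self _).trans (hD ω)⟩
  obtain ⟨K₂, hK₂m, hK₂b, hK₂⟩ := exists_isCondMean hm P hφm.sq.measurable (c := 0) (d := D ^ 2)
    fun ω => ⟨sq_nonneg _, pow_le_pow_left₀ (hφ0 ω) ((le_abs_self _).trans (hD ω)) 2⟩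
  have bK : BddMeasurable m K := .of_mem_Icc hKm hKb
  have bK₂ : BddMeasurable m K₂ := .of_mem_Icc hK₂m hK₂b
  -- The smallest conditional mean of `φ`; subtracting it discards the part where `M < M'`.
  set L : ℝ := ⨅ A : {A : Set Ω // MeasurableSet[m] A ∧ P A ≠ 0}, ∫ ω, φ ω ∂P[|A.1]
  have hbdd : BddBelow (Set.range fun A : {A : Set Ω // MeasurableSet[m] A ∧ P A ≠ 0} =>
      ∫ ω, φ ω ∂P[|A.1]) := ⟨0, by rintro _ ⟨A, rfl⟩; exact integral_nonneg hφ0⟩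
  have : Nonempty {A : Set Ω // MeasurableSet[m] A ∧ P A ≠ 0} := ⟨⟨Set.univ, .univ, by simp⟩⟩
  have hLK : ∀ᵐ ω ∂P, L ≤ K ω := by
    refine ae_le_of_setIntegral_le hm (BddMeasurable.const L) bK fun A hA h0 => ?_
    rw [hK.setIntegral hm hA, setIntegral_eq_mul_integral_cond h0 φ, setIntegral_const, smul_eq_mul]
    exact mul_le_mul_of_nonneg_left (ciInf_le hbdd ⟨A, hA, h0⟩) measureReal_nonneg
  have hKL : ∀ᵐ ω ∂P, ∀ q : ℚ, 0 < q → K ω - L ≤ q / 2 * K₂ ω + γ / (2 * q) := by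
    rw [ae_all_iff]
    intro q
    by_cases hq : 0 < q
    swap
    · exact .of_forall fun ω h => absurd h hq
    have hq' : (0 : ℝ) < q := by exact_mod_cast hq
    have : ∀ᵐ ω ∂P, K ω ≤ (q : ℝ) / 2 * K₂ ω + (L + γ / (2 * q)) := by
      refine ae_le_of_setIntegral_le hm bK
        (((BddMeasurable.const _).mul bK₂).add (BddMeasurable.const _)) fun A hA h0 => ?_
      have := cond_isProbabilityMeasure h0
      rw [integral_add ((bK₂.integrable hm _).const_mul _) (integrable_const _),
        integral_const_mul, hK.setIntegral hm hA, hK₂.setIntegral hm hA, setIntegral_const,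
        smul_eq_mul, setIntegral_eq_mul_integral_cond h0, setIntegral_eq_mul_integral_cond h0]
      have : ∫ ω, φ ω ∂P[|A] - q / 2 * ∫ ω, φ ω ^ 2 ∂P[|A] - γ / (2 * q) ≤ L := by
        refine le_ciInf fun B => ?_
        have := cond_isProbabilityMeasure B.2.2
        have := @integral_sub_integral_le_of_tv Ω 𝒮 ((P[|A]).trim h𝒮) ((P[|B.1]).trim h𝒮) _ _ γ
          (fun s hs => by
            simp only [Measure.real, trim_measurableSet_eq h𝒮 hs]
            exact hγ _ _ B.2.1 hA B.2.2 h0 s hs) φ hφ hφ0 q hq'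
        rw [← integral_trim h𝒮 hφ.measurable.stronglyMeasurable,
          ← integral_trim h𝒮 hφ.measurable.stronglyMeasurable,
          ← integral_trim h𝒮 hφ.sq.measurable.stronglyMeasurable] at this
        linarith
      have h2 := mul_le_mul_of_nonneg_left this (measureReal_nonneg (μ := P) (s := A))
      linarith
    filter_upwards [this] with ω hω _
    linarith
  have bKL : BddMeasurable m0 (fun ω => K ω - L) := (bK.sub (.const L)).mono hm
  have bMM' : BddMeasurable m (fun ω => M ω - M' ω) := hM.sub hM'
  have e1 : ∫ ω, φ ω * (M ω - M' ω) ∂P = ∫ ω, (K ω - L) * (M ω - M' ω) ∂P := by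
    have h1 : ∫ ω, (K ω - L) * (M ω - M' ω) ∂P
        = ∫ ω, (M ω - M' ω) * K ω ∂P - L * ∫ ω, (M ω - M' ω) ∂P := by
      rw [← integral_const_mul, ← integral_sub ((bMM'.mul bK).integrable hm P)
        ((bMM'.integrable hm P).const_mul L)]
      refine integral_congr_ae (.of_forall fun ω => ?_)
      simp only; ring
    rw [h1, hK _ bMM', integral_sub (hM.integrable hm P) (hM'.integrable hm P), hMM', sub_self,
      mul_zero, sub_zero]
    simp_rw [mul_comm]
  have e2 : ∫ ω, M ω * φ ω ^ 2 ∂P = ∫ ω, M ω * K₂ ω ∂P := (hK₂ _ hM).symm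
  have i1 := (hM.mul bK₂).integrable hm P
  have i2 := (bMM'.max_zero.sq.div hM.measurable hc hcM).integrable hm P
  rw [e1, e2, chiDiv, ← integral_const_mul, ← integral_div, ← integral_div,
    ← integral_add (i1.div_const 2) ((i2.const_mul γ).div_const 2)]
  refine integral_mono_ae ((bKL.mul (bMM'.mono hm)).integrable le_rfl P)
    ((i1.div_const 2).add ((i2.const_mul γ).div_const 2)) ?_
  filter_upwards [hLK, hKL] with ω h1 h2
  have hp : 0 < M ω := hc.trans_le (hcM ω)
  set v := max (M ω - M' ω) 0 with hv
  have h0 : 0 ≤ K ω - L := sub_nonneg.2 h1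
  have h3 : (K ω - L) * (M ω - M' ω) ≤ (K ω - L) * v :=
    mul_le_mul_of_nonneg_left (le_max_left _ _) h0
  refine h3.trans ?_
  change _ ≤ M ω * K₂ ω / 2 + γ * (v ^ 2 / M ω) / 2
  have hv0 : 0 ≤ v := le_max_right _ _
  rcases hv0.eq_or_lt with hv1 | hv1
  · rw [← hv1]
    have := mul_nonneg hp.le (hK₂b ω).1
    simp; linarith
  · have h4 := two_mul_le_of_forall_rat h0 (hK₂b ω).1 hγ0 h2 (M ω / v)
    have h5 := mul_le_mul_of_nonneg_left h4 (by positivity : 0 ≤ v ^ 2 / (2 * M ω))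
    calc (K ω - L) * v = v ^ 2 / (2 * M ω) * (2 * (M ω / v) * (K ω - L)) := by
          field_simp
      _ ≤ _ := h5
      _ = _ := by field_simp

end

/-! ### Samson's inequality -/

theorem sum_mul_sum_le_matOpNorm {T : ℕ} (G : Matrix (Fin T) (Fin T) ℝ) (u a : Fin T → ℝ) :
    ∑ j, u j * ∑ i, G i j * a i ≤ matOpNorm G * √(∑ j, u j ^ 2) * √(∑ i, a i ^ 2) := by
  have hn : ∀ x : Fin T → ℝ, ‖WithLp.toLp 2 x‖ = √(∑ i, x i ^ 2) := fun x => by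
    simp [EuclideanSpace.norm_eq]
  have h1 : ∑ j, u j * ∑ i, G i j * a i =
      ⟪WithLp.toLp 2 a, Matrix.toEuclideanCLM (𝕜 := ℝ) G (WithLp.toLp 2 u)⟫ := by
    simp only [PiLp.inner_apply, Matrix.toEuclideanCLM_toLp, Matrix.mulVec, dotProduct,
      RCLike.inner_apply, conj_trivial, Finset.sum_mul, Finset.mul_sum]
    rw [Finset.sum_comm]
    exact Finset.sum_congr rfl fun i _ => Finset.sum_congr rfl fun j _ => by ring
  rw [h1, ← hn, ← hn]
  calc _ ≤ ‖WithLp.toLp 2 a‖ * ‖Matrix.toEuclideanCLM (𝕜 := ℝ) G (WithLp.toLp 2 u)‖ :=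
        real_inner_le_norm _ _
    _ ≤ ‖WithLp.toLp 2 a‖ * (matOpNorm G * ‖WithLp.toLp 2 u‖) := by
        gcongr; exact ContinuousLinearMap.le_opNorm _ _
    _ = _ := by ring

section

variable {Ω : Type*} {m0 : MeasurableSpace Ω} {P : Measure Ω} [IsProbabilityMeasure P]

/-- A transport-entropy inequality: a density `h` changes the means of nonnegative functions
`g j` of the successive observations by at most the square root of its entropy. -/
theorem sum_integral_mul_sub_le_entropy {T : ℕ} {𝒢 : ℕ → MeasurableSpace Ω}
    (h𝒢 : ∀ i, 𝒢 i ≤ m0) (hmono : Monotone 𝒢) (hbot : 𝒢 0 = ⊥) {𝒮 : Fin T → MeasurableSpace Ω}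
    (h𝒮 : ∀ j, 𝒮 j ≤ 𝒢 (j + 1)) {G : Matrix (Fin T) (Fin T) ℝ} (hG0 : ∀ i j, 0 ≤ G i j)
    (hdiag : ∀ j, G j j = 1)
    (hmix : ∀ i j : Fin T, i < j → ∀ A A', MeasurableSet[𝒢 (i + 1)] A →
      MeasurableSet[𝒢 (i + 1)] A' → P A ≠ 0 → P A' ≠ 0 →
      ∀ E, MeasurableSet[𝒮 j] E → (P[|A']).real E - (P[|A]).real E ≤ G i j ^ 2)
    {g : Fin T → Ω → ℝ} (hg : ∀ j, BddMeasurable (𝒮 j) (g j)) (hg0 : ∀ j ω, 0 ≤ g j ω)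
    {h : Ω → ℝ} (hh : Measurable[𝒢 T] h) {c d : ℝ} (hc : 0 < c) (hcd : ∀ ω, h ω ∈ Set.Icc c d) :
    0 ≤ ∫ ω, h ω * Real.log (h ω) ∂P - (∫ ω, h ω ∂P) * Real.log (∫ ω, h ω ∂P) ∧
    ∑ j, ((∫ ω, h ω ∂P) * ∫ ω, g j ω ∂P - ∫ ω, g j ω * h ω ∂P) ≤
      matOpNorm G * √((∫ ω, h ω ∂P) * ∑ j, ∫ ω, g j ω ^ 2 ∂P) *
        √(2 * (∫ ω, h ω * Real.log (h ω) ∂P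
          - (∫ ω, h ω ∂P) * Real.log (∫ ω, h ω ∂P))) := by
  have hh0 : Measurable h := hh.mono (h𝒢 T) le_rfl
  have hex : ∀ i, ∃ M : Ω → ℝ, Measurable[𝒢 i] M ∧ (∀ ω, M ω ∈ Set.Icc c d) ∧
      IsCondMean P (𝒢 i) h M ∧ (Measurable[𝒢 i] h → M = h) := by
    intro i
    by_cases hi : Measurable[𝒢 i] h
    · exact ⟨h, hi, hcd, fun _ _ => rfl, fun _ => rfl⟩
    · obtain ⟨M, h1, h2, h3⟩ := exists_isCondMean (h𝒢 i) P hh0 hcd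
      exact ⟨M, h1, h2, h3, fun h => absurd h hi⟩
  choose M hMm hMb hM hMeq using hex
  have bM : ∀ i, BddMeasurable (𝒢 i) (M i) := fun i => .of_mem_Icc (hMm i) (hMb i)
  have bM0 : ∀ i, BddMeasurable m0 (M i) := fun i => (bM i).mono (h𝒢 i)
  have hcM : ∀ i ω, c ≤ M i ω := fun i ω => (hMb i ω).1
  set h0 := ∫ ω, h ω ∂P with hh0def
  have hMT : M T = h := hMeq T hh
  have hMzero : M 0 = fun _ => h0 := by
    have h1 := hMm 0
    rw [hbot] at h1
    obtain ⟨k, hk⟩ := eq_const_of_measurable_bot h1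
    have h2 := (hM 0).integral_eq
    rw [hk] at h2
    simp only [integral_const, probReal_univ, one_smul] at h2
    rw [hk, h2]
  have h0pos : 0 < h0 := by
    obtain ⟨ω⟩ : Nonempty Ω := nonempty_of_isProbabilityMeasure P
    have := hcM 0 ω
    rw [hMzero] at this
    exact hc.trans_le this
  have htower : ∀ i, IsCondMean P (𝒢 i) (M (i + 1)) (M i) := fun i ζ hζ => by
    rw [hM i ζ hζ, hM (i + 1) ζ (hζ.mono (hmono (Nat.le_succ i)))]
  set Ent := ∫ ω, h ω * Real.log (h ω) ∂P - h0 * Real.log h0 with hEnt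
  have hchi0 : ∀ i, 0 ≤ chiDiv P (M i) (M (i + 1)) := fun i =>
    chiDiv_nonneg fun ω => hc.le.trans (hcM i ω)
  have hsum : ∑ i ∈ Finset.range T, chiDiv P (M i) (M (i + 1)) ≤ 2 * Ent := by
    calc _ ≤ ∑ i ∈ Finset.range T, 2 * (∫ ω, M (i + 1) ω * Real.log (M (i + 1) ω) ∂P
            - ∫ ω, M i ω * Real.log (M i ω) ∂P) :=
          Finset.sum_le_sum fun i _ => chiDiv_le_entropy_step (h𝒢 i) hc (bM i) (bM0 (i + 1))
            (hcM i) (hcM (i + 1)) (htower i)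
      _ = 2 * Ent := by
          rw [← Finset.mul_sum, Finset.sum_range_sub
            (fun i => ∫ ω, M i ω * Real.log (M i ω) ∂P), hMT, hMzero, hEnt]
          simp
  have hEnt0 : 0 ≤ Ent := by
    have := Finset.sum_nonneg fun i (_ : i ∈ Finset.range T) => hchi0 i
    linarith
  refine ⟨hEnt0, ?_⟩
  have hj : ∀ j : Fin T, h0 * ∫ ω, g j ω ∂P - ∫ ω, g j ω * h ω ∂P ≤
      √(h0 * ∫ ω, g j ω ^ 2 ∂P) * ∑ i : Fin T, G i j * √(chiDiv P (M i) (M (i + 1))) := by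
    intro j
    have h𝒮0 : 𝒮 j ≤ m0 := (h𝒮 j).trans (h𝒢 _)
    have hex : ∀ i, ∃ b : Ω → ℝ, Measurable[𝒮 j] b ∧ (∀ ω, b ω ∈ Set.Icc c d) ∧
        IsCondMean P (𝒮 j) (M i) b := fun i =>
      exists_isCondMean h𝒮0 P (bM0 i).measurable (hMb i)
    choose b hbm hbb hb using hex
    have bb : ∀ i, BddMeasurable (𝒮 j) (b i) := fun i => .of_mem_Icc (hbm i) (hbb i)
    have bb0 : ∀ i, BddMeasurable m0 (b i) := fun i => (bb i).mono h𝒮0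
    have bg0 := (hg j).mono h𝒮0
    have hchain := integral_mul_sub_le_sum_chiDiv (P := P) hc bb0 (fun i ω => (hbb i ω).1) bg0
      (hg0 j) (j + 1)
    have e1 : ∫ ω, g j ω * (b 0 ω - b (j + 1) ω) ∂P =
        h0 * ∫ ω, g j ω ∂P - ∫ ω, g j ω * h ω ∂P := by
      simp_rw [mul_sub]
      rw [integral_sub ((bg0.mul (bb0 0)).integrable le_rfl P)
        ((bg0.mul (bb0 _)).integrable le_rfl P), hb _ _ (hg j), hb _ _ (hg j),
        hM _ _ ((hg j).mono (h𝒮 j)), hMzero, integral_mul_const, mul_comm]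
    have e2 : ∫ ω, g j ω ^ 2 * b 0 ω ∂P = h0 * ∫ ω, g j ω ^ 2 ∂P := by
      rw [hb _ _ (hg j).sq, hMzero, integral_mul_const, mul_comm]
    rw [e1, e2] at hchain
    refine hchain.trans (mul_le_mul_of_nonneg_left ?_ (Real.sqrt_nonneg _))
    have hstep : ∀ i (hi : i < (j : ℕ) + 1), chiDiv P (b i) (b (i + 1)) ≤
        G ⟨i, by omega⟩ j ^ 2 * chiDiv P (M i) (M (i + 1)) := by
      intro i hi
      refine chiDiv_condMean_le h𝒮0 hc (bM0 i) (bM0 (i + 1)) (bb i) (bb (i + 1))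
        (fun ω => (hbb i ω).1) (hb i) (hb (i + 1)) fun φ hφ hφ0 => ?_
      rcases (Nat.lt_succ_iff.1 hi).eq_or_lt with hij | hij
      · have : (⟨i, by omega⟩ : Fin T) = j := Fin.ext hij
        rw [this, hdiag, one_pow, one_mul]
        exact integral_mul_sub_le_chiDiv hc (bM0 i) (bM0 (i + 1)) (hcM i) (hφ.mono h𝒮0) hφ0
      · exact integral_mul_sub_le_of_mixing (h𝒢 (i + 1)) h𝒮0 (sq_nonneg _)
          (hmix ⟨i, by omega⟩ j hij) hc ((bM i).mono (hmono (Nat.le_succ i))) (bM (i + 1))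
          (hcM i) (htower i).integral_eq hφ hφ0
    let f : ℕ → ℝ := fun i =>
      if hi : i < T then G ⟨i, hi⟩ j * √(chiDiv P (M i) (M (i + 1))) else 0
    have hf0 : ∀ i, 0 ≤ f i := fun i => by
      dsimp only [f]
      split_ifs
      · exact mul_nonneg (hG0 _ _) (Real.sqrt_nonneg _)
      · exact le_rfl
    calc ∑ i ∈ Finset.range (j + 1), √(chiDiv P (b i) (b (i + 1)))
        ≤ ∑ i ∈ Finset.range (j + 1), f i := by
          refine Finset.sum_le_sum fun i hi => ?_
          have hi' := Finset.mem_range.1 hi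
          have hiT : i < T := by omega
          simp only [f, hiT, dif_pos]
          rw [← Real.sqrt_sq (hG0 ⟨i, hiT⟩ j), ← Real.sqrt_mul (sq_nonneg _)]
          exact Real.sqrt_le_sqrt (hstep i hi')
      _ ≤ ∑ i ∈ Finset.range T, f i :=
          Finset.sum_le_sum_of_subset_of_nonneg
            (Finset.range_subset_range.2 j.2) fun i _ _ => hf0 i
      _ = _ := by
          rw [Finset.sum_range]
          exact Finset.sum_congr rfl fun i _ => by simp [f]
  refine (Finset.sum_le_sum fun j _ => hj j).trans ?_
  refine (sum_mul_sum_le_matOpNorm G _ _).trans ?_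
  have e3 : ∑ j, √(h0 * ∫ ω, g j ω ^ 2 ∂P) ^ 2 = h0 * ∑ j, ∫ ω, g j ω ^ 2 ∂P := by
    rw [Finset.mul_sum]
    exact Finset.sum_congr rfl fun j _ => Real.sq_sqrt
      (mul_nonneg h0pos.le (integral_nonneg fun ω => sq_nonneg _))
  have e4 : ∑ i : Fin T, √(chiDiv P (M i) (M (i + 1))) ^ 2 ≤ 2 * Ent := by
    refine le_trans (le_of_eq ?_) hsum
    rw [Finset.sum_range]
    exact Finset.sum_congr rfl fun i _ => Real.sq_sqrt (hchi0 i)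
  rw [e3]
  exact mul_le_mul_of_nonneg_left (Real.sqrt_le_sqrt e4)
    (mul_nonneg (norm_nonneg _) (Real.sqrt_nonneg _))

/-- Samson's bound on the lower Laplace transform of a sum of nonnegative functions of dependent
observations. -/
theorem integral_exp_neg_sum_le {T : ℕ} {𝒢 : ℕ → MeasurableSpace Ω}
    (h𝒢 : ∀ i, 𝒢 i ≤ m0) (hmono : Monotone 𝒢) (hbot : 𝒢 0 = ⊥) {𝒮 : Fin T → MeasurableSpace Ω}
    (h𝒮 : ∀ j, 𝒮 j ≤ 𝒢 (j + 1)) {G : Matrix (Fin T) (Fin T) ℝ} (hG0 : ∀ i j, 0 ≤ G i j)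
    (hdiag : ∀ j, G j j = 1)
    (hmix : ∀ i j : Fin T, i < j → ∀ A A', MeasurableSet[𝒢 (i + 1)] A →
      MeasurableSet[𝒢 (i + 1)] A' → P A ≠ 0 → P A' ≠ 0 →
      ∀ E, MeasurableSet[𝒮 j] E → (P[|A']).real E - (P[|A]).real E ≤ G i j ^ 2)
    {g : Fin T → Ω → ℝ} (hg : ∀ j, BddMeasurable (𝒮 j) (g j)) (hg0 : ∀ j ω, 0 ≤ g j ω)
    {l : ℝ} (hl : 0 ≤ l) :
    ∫ ω, Real.exp (-(l * ∑ j, g j ω)) ∂P ≤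
      Real.exp (-(l * ∑ j, ∫ ω, g j ω ∂P)
        + l ^ 2 / 2 * (matOpNorm G ^ 2 * ∑ j, ∫ ω, g j ω ^ 2 ∂P)) := by
  have bgT : ∀ j, BddMeasurable (𝒢 T) (g j) := fun j =>
    (hg j).mono ((h𝒮 j).trans (hmono j.2))
  have bZ : BddMeasurable (𝒢 T) (fun ω => ∑ j, g j ω) := BddMeasurable.sum fun j _ => bgT j
  obtain ⟨D, hD⟩ := bZ.bounded
  have hZ0 : ∀ ω, 0 ≤ ∑ j, g j ω := fun ω => Finset.sum_nonneg fun j _ => hg0 j ω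
  set h : Ω → ℝ := fun ω => Real.exp (-(l * ∑ j, g j ω)) with hdef
  have hh : Measurable[𝒢 T] h := Real.measurable_exp.comp (bZ.measurable.const_mul l).neg
  have hcd : ∀ ω, h ω ∈ Set.Icc (Real.exp (-(l * D))) 1 := fun ω =>
    ⟨Real.exp_le_exp.2 (neg_le_neg (mul_le_mul_of_nonneg_left ((le_abs_self _).trans (hD ω)) hl)),
      Real.exp_le_one_iff.2 (neg_nonpos.2 (mul_nonneg hl (hZ0 ω)))⟩
  have bh : BddMeasurable (𝒢 T) h := .of_mem_Icc hh hcd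
  obtain ⟨hE0, hE⟩ := sum_integral_mul_sub_le_entropy h𝒢 hmono hbot h𝒮 hG0 hdiag hmix hg hg0 hh
    (Real.exp_pos _) hcd
  set h0 := ∫ ω, h ω ∂P with hh0
  have h0pos : 0 < h0 := by
    have : ∫ _, Real.exp (-(l * D)) ∂P ≤ h0 :=
      integral_mono (integrable_const _) (bh.integrable (h𝒢 T) P) fun ω => (hcd ω).1
    simp only [integral_const, probReal_univ, one_smul] at this
    exact (Real.exp_pos _).trans_le this
  set V := ∑ j, ∫ ω, g j ω ^ 2 ∂P with hV
  have hV0 : 0 ≤ V := Finset.sum_nonneg fun j _ => integral_nonneg fun ω => sq_nonneg _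
  have hlog : ∫ ω, h ω * Real.log (h ω) ∂P = -(l * ∑ j, ∫ ω, g j ω * h ω ∂P) := by
    rw [← integral_finsetSum _ fun j _ => ((bgT j).mul bh).integrable (h𝒢 T) P,
      ← integral_const_mul, ← integral_neg]
    refine integral_congr_ae (.of_forall fun ω => ?_)
    simp only [hdef, Real.log_exp, ← Finset.sum_mul]
    ring
  set Ent := ∫ ω, h ω * Real.log (h ω) ∂P - h0 * Real.log h0 with hEnt
  rw [Finset.sum_sub_distrib, ← Finset.mul_sum] at hE
  have hAG : l * (matOpNorm G * √(h0 * V) * √(2 * Ent)) ≤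
      Ent + h0 * (l ^ 2 / 2 * (matOpNorm G ^ 2 * V)) := by
    have s1 : √(h0 * V) ^ 2 = h0 * V := Real.sq_sqrt (by positivity)
    have s2 : √(2 * Ent) ^ 2 = 2 * Ent := Real.sq_sqrt (by positivity)
    have s3 : (l * matOpNorm G * √(h0 * V)) ^ 2 = l ^ 2 * matOpNorm G ^ 2 * (h0 * V) := by
      rw [mul_pow, s1, mul_pow]
    have s4 := two_mul_le_add_sq (l * matOpNorm G * √(h0 * V)) √(2 * Ent)
    rw [s2, s3] at s4
    linarith
  have hE' := mul_le_mul_of_nonneg_left hE hl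
  have hfin : h0 * Real.log h0 ≤ h0 * (-(l * ∑ j, ∫ ω, g j ω ∂P)
        + l ^ 2 / 2 * (matOpNorm G ^ 2 * V)) := by
    linarith
  rw [← Real.log_le_iff_le_exp h0pos]
  exact le_of_mul_le_mul_left hfin h0pos

end

/-! ### Concentration along a trajectory -/

section

variable {T d : ℕ}

theorem measurable_futureProj (j : Fin T) :
    Measurable (fun (x : Traj T d) (s : Set.Ici j) => x s) :=
  measurable_pi_lambda _ fun _ => measurable_pi_apply _

theorem abs_real_sub_real_le_one {E : Type*} [MeasurableSpace E] (μ ν : Measure E)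
    [IsProbabilityMeasure μ] [IsProbabilityMeasure ν] (A : Set E) :
    |μ.real A - ν.real A| ≤ 1 := by
  have h1 : μ.real A ≤ 1 := measureReal_le_one
  have h2 : ν.real A ≤ 1 := measureReal_le_one
  have h3 : 0 ≤ μ.real A := measureReal_nonneg
  have h4 : 0 ≤ ν.real A := measureReal_nonneg
  exact abs_sub_le_iff.2 ⟨by linarith, by linarith⟩

theorem abs_real_sub_real_le_tvNorm {E : Type*} [MeasurableSpace E] (μ ν : Measure E)
    [IsProbabilityMeasure μ] [IsProbabilityMeasure ν] {A : Set E} (hA : MeasurableSet A) :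
    |μ.real A - ν.real A| ≤ tvNorm μ ν :=
  le_ciSup (f := fun A : {A : Set E // MeasurableSet A} => |μ.real A.1 - ν.real A.1|)
    ⟨1, by rintro _ ⟨A, rfl⟩; exact abs_real_sub_real_le_one μ ν A.1⟩ ⟨A, hA⟩

theorem tvNorm_le_one {E : Type*} [MeasurableSpace E] (μ ν : Measure E)
    [IsProbabilityMeasure μ] [IsProbabilityMeasure ν] : tvNorm μ ν ≤ 1 := by
  have : Nonempty {A : Set E // MeasurableSet A} := ⟨⟨∅, .empty⟩⟩
  exact ciSup_le fun A => abs_real_sub_real_le_one μ ν A.1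

theorem isProbabilityMeasure_futureLaw (P : Measure (Traj T d)) [IsProbabilityMeasure P]
    (j : Fin T) : IsProbabilityMeasure (futureLaw P j) :=
  Measure.isProbabilityMeasure_map (measurable_futureProj j).aemeasurable

theorem dependencyMatrix_nonneg (P : Measure (Traj T d)) (i j : Fin T) :
    0 ≤ dependencyMatrix P i j := by
  simp only [dependencyMatrix, Matrix.of_apply]
  split_ifs
  · exact Real.sqrt_nonneg _
  · exact zero_le_one
  · exact le_rfl

/-- Conditioning on two events of the past changes the law of a later coordinate by at most the
squared entry of the dependency matrix: both conditional laws are compared with the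
unconditional one, which is where the factor two in the matrix comes from. -/
theorem cond_real_sub_le_dependencyMatrix_sq (P : Measure (Traj T d)) [IsProbabilityMeasure P]
    {i j : Fin T} (hij : i < j) {A A' : Set (Traj T d)} (hA : MeasurableSet[pastSigma i] A)
    (hA' : MeasurableSet[pastSigma i] A') (h0 : P A ≠ 0) (h0' : P A' ≠ 0) {E : Set (Euc d)}
    (hE : MeasurableSet E) :
    (P[|A']).real ((fun x : Traj T d => x j) ⁻¹' E)
      - (P[|A]).real ((fun x : Traj T d => x j) ⁻¹' E) ≤ dependencyMatrix P i j ^ 2 := by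
  set τ : ℝ := ⨆ A : {A : Set (Traj T d) // MeasurableSet[pastSigma i] A ∧ P A ≠ 0},
        tvNorm (futureLaw (P[|A.1]) j) (futureLaw P j) with hτ
  have hP := isProbabilityMeasure_futureLaw P j
  have key : ∀ A : Set (Traj T d), MeasurableSet[pastSigma i] A → P A ≠ 0 →
      |(P[|A]).real ((fun x : Traj T d => x j) ⁻¹' E)
        - P.real ((fun x : Traj T d => x j) ⁻¹' E)| ≤ τ := by
    intro A hA h0
    have := cond_isProbabilityMeasure h0
    have := isProbabilityMeasure_futureLaw (P[|A]) j
    have hE' : MeasurableSet {y : Set.Ici j → Euc d | y ⟨j, Set.mem_Ici.2 le_rfl⟩ ∈ E} :=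
      measurable_pi_apply _ hE
    have h1 := abs_real_sub_real_le_tvNorm (futureLaw (P[|A]) j) (futureLaw P j) hE'
    simp only [futureLaw, map_measureReal_apply (measurable_futureProj j) hE'] at h1
    refine le_trans h1 (le_ciSup (f := fun A : {A : Set (Traj T d) //
      MeasurableSet[pastSigma i] A ∧ P A ≠ 0} => tvNorm (futureLaw (P[|A.1]) j) (futureLaw P j))
      ⟨1, ?_⟩ ⟨A, hA, h0⟩)
    rintro _ ⟨A, rfl⟩
    have := cond_isProbabilityMeasure A.2.2
    have := isProbabilityMeasure_futureLaw (P[|A.1]) j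
    exact tvNorm_le_one _ _
  have k1 := key A hA h0
  have k2 := key A' hA' h0'
  have hτ0 : 0 ≤ τ := (abs_nonneg _).trans k1
  have hΓ : dependencyMatrix P i j ^ 2 = 2 * τ := by
    simp only [dependencyMatrix, Matrix.of_apply, if_pos hij]
    exact Real.sq_sqrt (by positivity)
  rw [hΓ]
  have := (abs_le.1 k1).1
  have := (abs_le.1 k2).2
  linarith

/-- Samson's inequality for the law of a trajectory and its dependency matrix. -/
theorem integral_exp_neg_sum_le_dependencyMatrix (P : Measure (Traj T d))
    [IsProbabilityMeasure P] {g : Euc d → ℝ} (hg : BddMeasurable inferInstance g)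
    (hg0 : ∀ x, 0 ≤ g x) {l : ℝ} (hl : 0 ≤ l) :
    ∫ x, Real.exp (-(l * ∑ t : Fin T, g (x t))) ∂P ≤
      Real.exp (-(l * ∑ t : Fin T, ∫ x, g (x t) ∂P)
        + l ^ 2 / 2 * (matOpNorm (dependencyMatrix P) ^ 2 *
          ∑ t : Fin T, ∫ x, g (x t) ^ 2 ∂P)) := by
  let 𝒮 : Fin T → MeasurableSpace (Traj T d) := fun j =>
    MeasurableSpace.comap (fun x => x j) inferInstance
  let 𝒢 : ℕ → MeasurableSpace (Traj T d) := fun i => ⨆ s : Fin T, ⨆ _ : (s : ℕ) < i, 𝒮 s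
  have h𝒮0 : ∀ j, 𝒮 j ≤ MeasurableSpace.pi := fun j => (measurable_pi_apply j).comap_le
  have h𝒢past : ∀ i : Fin T, 𝒢 (i + 1) ≤ pastSigma i := by
    intro i
    refine iSup₂_le fun s hs => ?_
    rintro _ ⟨E, hE, rfl⟩
    exact ⟨_, measurable_pi_apply (⟨s, Nat.lt_succ_iff.1 hs⟩ : Set.Iic i) hE, rfl⟩
  refine integral_exp_neg_sum_le (P := P) (𝒢 := 𝒢) (𝒮 := 𝒮) (g := fun t x => g (x t))
    (fun i => iSup₂_le fun s _ => h𝒮0 s)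
    (fun i k hik => iSup_mono fun s => iSup_mono' fun hs => ⟨hs.trans_le hik, le_rfl⟩)
    (by simp [𝒢]) (fun j => le_iSup₂_of_le j (Nat.lt_succ_self _) le_rfl)
    (dependencyMatrix_nonneg P) (fun j => by simp [dependencyMatrix]) ?_
    (fun j => ⟨hg.measurable.comp (comap_measurable _), ?_⟩) (fun j x => hg0 _) hl
  · rintro i j hij A A' hA hA' h0 h0' _ ⟨E, hE, rfl⟩
    exact cond_real_sub_le_dependencyMatrix_sq P hij (h𝒢past i _ hA) (h𝒢past i _ hA') h0 h0' hE
  · obtain ⟨D, hD⟩ := hg.bounded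
    exact ⟨D, fun x => hD _⟩

theorem measureReal_sum_le_half_le (P : Measure (Traj T d)) [IsProbabilityMeasure P]
    {g : Euc d → ℝ} (hg : BddMeasurable inferInstance g) (hg0 : ∀ x, 0 ≤ g x) {V : ℝ}
    (hV0 : 0 < V) (hV : ∑ t : Fin T, ∫ x, g (x t) ^ 2 ∂P ≤ V) :
    P.real {x | ∑ t : Fin T, g (x t) ≤ (∑ t : Fin T, ∫ x, g (x t) ∂P) / 2} ≤
      Real.exp (-((∑ t : Fin T, ∫ x, g (x t) ∂P) ^ 2 /
        (8 * (matOpNorm (dependencyMatrix P) ^ 2 * V)))) := by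
  set N := matOpNorm (dependencyMatrix P)
  set m := ∑ t : Fin T, ∫ x, g (x t) ∂P with hm
  have hm0 : 0 ≤ m := Finset.sum_nonneg fun t _ => integral_nonneg fun x => hg0 _
  rcases (sq_nonneg N).eq_or_lt with hN | hN
  · rw [← hN]; simp
  set D := N ^ 2 * V with hD
  have hD0 : 0 < D := mul_pos hN hV0
  -- The minimizer of the Chernoff exponent `-l * m / 2 + l ^ 2 * D / 2`.
  set l := m / (2 * D) with hl
  have hl0 : 0 ≤ l := by positivity
  have bg : ∀ t : Fin T, BddMeasurable MeasurableSpace.pi (fun x : Traj T d => g (x t)) := by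
    intro t
    obtain ⟨E, hE⟩ := hg.bounded
    exact ⟨hg.measurable.comp (measurable_pi_apply t), E, fun x => hE _⟩
  have bZ : BddMeasurable MeasurableSpace.pi (fun x : Traj T d => ∑ t : Fin T, g (x t)) :=
    .sum fun t _ => bg t
  have hint : Integrable (fun x : Traj T d => Real.exp (-l * ∑ t : Fin T, g (x t))) P := by
    refine (BddMeasurable.of_mem_Icc (c := 0) (d := 1)
      (Real.measurable_exp.comp (bZ.measurable.const_mul (-l)))
      fun x => ⟨(Real.exp_pos _).le, Real.exp_le_one_iff.2 ?_⟩).integrable le_rfl P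
    have := Finset.sum_nonneg fun t (_ : t ∈ Finset.univ) => hg0 (x t)
    nlinarith
  have h1 := measure_le_le_exp_mul_mgf (μ := P) (X := fun x : Traj T d => ∑ t : Fin T, g (x t))
    (m / 2) (neg_nonpos.2 hl0) hint
  have h2 := integral_exp_neg_sum_le_dependencyMatrix P hg hg0 hl0
  refine h1.trans ?_
  simp only [mgf, neg_mul, neg_neg]
  refine (mul_le_mul_of_nonneg_left h2 (Real.exp_pos _).le).trans ?_
  rw [← Real.exp_add, Real.exp_le_exp]
  have h3 : l ^ 2 / 2 * (N ^ 2 * ∑ t : Fin T, ∫ x, g (x t) ^ 2 ∂P) ≤ l ^ 2 / 2 * D := by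
    rw [hD]; gcongr
  have h4 : l * (m / 2) + (-(l * m) + l ^ 2 / 2 * D) = -(m ^ 2 / (8 * D)) := by
    rw [hl]; field_simp; ring
  linarith

/-- The mean square of `f` along the trajectory `x`. -/
noncomputable def empSq {dy : ℕ} (x : Traj T d) (f : Euc d → Euc dy) : ℝ :=
  (1 / (T : ℝ)) * ∑ t : Fin T, ‖f (x t)‖ ^ 2

theorem measurable_empSq {dy : ℕ} {f : Euc d → Euc dy} (hf : Measurable f) :
    Measurable (fun x : Traj T d => empSq x f) :=
  (Finset.measurable_sum _ fun t _ =>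
    ((hf.comp (measurable_pi_apply t)).norm.pow_const 2)).const_mul _

/-- Hypercontractivity turns the concentration inequality into a lower isometry for one
function. -/
theorem measureReal_empSq_le_half_le {dy : ℕ} (hT : 0 < T) (P : Measure (Traj T d))
    [IsProbabilityMeasure P] {f : Euc d → Euc dy} (hf : Measurable f) {B : ℝ}
    (hB : ∀ᵐ x ∂P, ∀ t, ‖f (x t)‖ ≤ B) {r C α : ℝ} (hr : 0 < r) (hC : 0 < C)
    (h2 : lpPow P 2 f = r ^ 2) (h4 : lpPow P 4 f ≤ C * (lpPow P 2 f) ^ α) :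
    P.real {x | empSq x f ≤ r ^ 2 / 2} ≤
      Real.exp (-((T : ℝ) * r ^ (4 - 2 * α)) /
        (8 * C * matOpNorm (dependencyMatrix P) ^ 2)) := by
  have hT' : (0 : ℝ) < T := by exact_mod_cast hT
  -- Truncation makes the function bounded everywhere without changing it along trajectories.
  let g : Euc d → ℝ := fun x => min (‖f x‖ ^ 2) (B ^ 2)
  have hg : BddMeasurable inferInstance g :=
    .of_mem_Icc (c := 0) (d := B ^ 2) ((hf.norm.pow_const 2).min measurable_const) fun x =>
      ⟨le_min (sq_nonneg _) (sq_nonneg _), min_le_right _ _⟩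
  have hgf : ∀ᵐ x ∂P, ∀ t, g (x t) = ‖f (x t)‖ ^ 2 := by
    filter_upwards [hB] with x hx t
    exact min_eq_left (pow_le_pow_left₀ (norm_nonneg _) (hx t) 2)
  have e1 : ∑ t : Fin T, ∫ x, g (x t) ∂P = T * r ^ 2 := by
    rw [← h2, lpPow, ← mul_assoc, mul_one_div_cancel hT'.ne', one_mul]
    exact Finset.sum_congr rfl fun t _ => integral_congr_ae (hgf.mono fun x hx => hx t)
  have hrpow : (r ^ 2) ^ α = r ^ (2 * α) := by
    rw [← Real.rpow_natCast r 2, ← Real.rpow_mul hr.le]; norm_num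
  have e2 : ∑ t : Fin T, ∫ x, g (x t) ^ 2 ∂P ≤ T * (C * r ^ (2 * α)) := by
    rw [h2, hrpow] at h4
    have : ∑ t : Fin T, ∫ x, g (x t) ^ 2 ∂P = T * lpPow P 4 f := by
      rw [lpPow, ← mul_assoc, mul_one_div_cancel hT'.ne', one_mul]
      refine Finset.sum_congr rfl fun t _ => integral_congr_ae (hgf.mono fun x hx => ?_)
      simp only [hx t]; ring
    rw [this]; gcongr
  have hV0 : 0 < (T : ℝ) * (C * r ^ (2 * α)) := by positivity
  have := measureReal_sum_le_half_le P hg (fun x => le_min (sq_nonneg _) (sq_nonneg _)) hV0 e2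
  rw [e1] at this
  refine le_trans (le_of_eq (measureReal_congr ?_)) (this.trans (le_of_eq ?_))
  · filter_upwards [hgf] with x hx
    refine propext ?_
    change empSq x f ≤ r ^ 2 / 2 ↔ ∑ t : Fin T, g (x t) ≤ T * r ^ 2 / 2
    simp only [empSq, hx]
    rw [one_div, inv_mul_le_iff₀ hT', mul_div_assoc]
  · congr 1
    rw [neg_div]
    congr 1
    have e3 : r ^ (4 - 2 * α) = r ^ 4 / r ^ (2 * α) := by
      rw [Real.rpow_sub hr, ← Real.rpow_natCast r 4]; norm_num
    have hp : 0 < r ^ (2 * α) := Real.rpow_pos_of_pos hr _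
    rw [e3]
    by_cases hN : matOpNorm (dependencyMatrix P) = 0
    · simp [hN]
    · field_simp

end

/-! ### Deterministic inequalities for least squares -/

section

variable {T dx dy : ℕ}

theorem four_inner_sub_sq_le (w v : Euc dy) : 4 * ⟪w, v⟫ - ‖v‖ ^ 2 ≤ 4 * ‖w‖ ^ 2 := by
  have := real_inner_le_norm w v
  nlinarith [sq_nonneg (2 * ‖w‖ - ‖v‖)]

theorem offset_le (w : Fin T → Euc dy) (x : Fin T → Euc dx) (f : Euc dx → Euc dy) :
    (1 / (T : ℝ)) * ∑ t : Fin T, (4 * ⟪w t, f (x t)⟫ - ‖f (x t)‖ ^ 2) ≤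
      (1 / (T : ℝ)) * ∑ t : Fin T, 4 * ‖w t‖ ^ 2 :=
  mul_le_mul_of_nonneg_left (Finset.sum_le_sum fun t _ => four_inner_sub_sq_le _ _)
    (by positivity)

theorem le_offsetComplexity {H : Set (Euc dx → Euc dy)} (w : Fin T → Euc dy)
    (x : Fin T → Euc dx) {f : Euc dx → Euc dy} (hf : f ∈ H) :
    (1 / (T : ℝ)) * ∑ t : Fin T, (4 * ⟪w t, f (x t)⟫ - ‖f (x t)‖ ^ 2) ≤
      offsetComplexity H w x :=
  le_ciSup (f := fun f : H => (1 / (T : ℝ)) *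
    ∑ t : Fin T, (4 * ⟪w t, f.1 (x t)⟫ - ‖f.1 (x t)‖ ^ 2))
    ⟨_, by rintro _ ⟨f, rfl⟩; exact offset_le w x f.1⟩ ⟨f, hf⟩

theorem offsetComplexity_nonneg {H : Set (Euc dx → Euc dy)} (h0 : (0 : Euc dx → Euc dy) ∈ H)
    (w : Fin T → Euc dy) (x : Fin T → Euc dx) : 0 ≤ offsetComplexity H w x := by
  simpa using le_offsetComplexity w x h0

theorem offsetComplexity_le {H : Set (Euc dx → Euc dy)} (h0 : (0 : Euc dx → Euc dy) ∈ H)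
    (w : Fin T → Euc dy) (x : Fin T → Euc dx) :
    offsetComplexity H w x ≤ (1 / (T : ℝ)) * ∑ t : Fin T, 4 * ‖w t‖ ^ 2 := by
  have : Nonempty H := ⟨⟨0, h0⟩⟩
  exact ciSup_le fun f => offset_le w x f.1

theorem zero_mem_shiftedClass {F : Set (Euc dx → Euc dy)} {fstar : Euc dx → Euc dy}
    (h : fstar ∈ F) : (0 : Euc dx → Euc dy) ∈ shiftedClass F fstar :=
  ⟨fstar, h, sub_self _⟩

/-- The basic inequality of least squares: comparing the loss of the estimator with the loss of the
truth bounds the empirical error by the offset complexity. -/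
theorem empSq_le_offsetComplexity {F : Set (Euc dx → Euc dy)} {fstar fhat : Euc dx → Euc dy}
    (hfstar : fstar ∈ F) {x : Fin T → Euc dx} {y w : Fin T → Euc dy}
    (hy : ∀ t, y t = fstar (x t) + w t) (hls : IsLeastSquares F x y fhat) :
    empSq x (fhat - fstar) ≤ offsetComplexity (shiftedClass F fstar) w x := by
  have h1 := hls.2 fstar hfstar
  have h2 := le_offsetComplexity w x (H := shiftedClass F fstar)
    (f := fhat - fstar) ⟨fhat, hls.1, rfl⟩
  refine le_trans ?_ h2
  have e1 : empiricalLoss x y fhat = empiricalLoss x y fstar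
      - 2 * ((1 / (T : ℝ)) * ∑ t : Fin T, ⟪w t, (fhat - fstar) (x t)⟫)
      + empSq x (fhat - fstar) := by
    simp only [empiricalLoss, empSq, Finset.mul_sum, ← Finset.sum_sub_distrib,
      ← Finset.sum_add_distrib]
    refine Finset.sum_congr rfl fun t _ => ?_
    have a1 : y t - fhat (x t) = w t - (fhat - fstar) (x t) := by
      rw [hy, Pi.sub_apply]; abel
    have a2 : y t - fstar (x t) = w t := by rw [hy]; abel
    rw [a1, a2, norm_sub_sq_real]
    ring
  have e2 : (1 / (T : ℝ)) * ∑ t : Fin T,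
      (4 * ⟪w t, (fhat - fstar) (x t)⟫ - ‖(fhat - fstar) (x t)‖ ^ 2) =
      4 * ((1 / (T : ℝ)) * ∑ t : Fin T, ⟪w t, (fhat - fstar) (x t)⟫)
        - empSq x (fhat - fstar) := by
    simp only [empSq, Finset.sum_sub_distrib, ← Finset.mul_sum]
    ring
  rw [e2]
  linarith

theorem norm_le_of_supNormOn_le {S : Set (Euc dx)} {f : Euc dx → Euc dy} {b : ℝ} (hb : 0 ≤ b)
    (h : supNormOn S f ≤ ENNReal.ofReal b) {x : Euc dx} (hx : x ∈ S) : ‖f x‖ ≤ b := by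
  have h1 : ‖f x‖ₑ ≤ ENNReal.ofReal b :=
    (le_iSup₂ (f := fun x (_ : x ∈ S) => ‖f x‖ₑ) x hx).trans h
  rw [← ofReal_norm] at h1
  exact (ENNReal.ofReal_le_ofReal_iff hb).1 h1

theorem lpPow_two_nonneg (P : Measure (Traj T dx)) (f : Euc dx → Euc dy) : 0 ≤ lpPow P 2 f :=
  mul_nonneg (by positivity)
    (Finset.sum_nonneg fun t _ => integral_nonneg fun x => sq_nonneg _)

theorem lpPow_two_le (P : Measure (Traj T dx)) [IsProbabilityMeasure P]
    {f : Euc dx → Euc dy} (hT : 0 < T) {B : ℝ} (hB : ∀ᵐ x ∂P, ∀ t, ‖f (x t)‖ ≤ B) :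
    lpPow P 2 f ≤ B ^ 2 := by
  have hT' : (0 : ℝ) < T := by exact_mod_cast hT
  have h1 : ∀ t : Fin T, ∫ x, ‖f (x t)‖ ^ 2 ∂P ≤ B ^ 2 := by
    intro t
    have := integral_mono_of_nonneg (μ := P) (f := fun x => ‖f (x t)‖ ^ 2)
      (.of_forall fun x => sq_nonneg _) (integrable_const (B ^ 2))
      (hB.mono fun x hx => pow_le_pow_left₀ (norm_nonneg _) (hx t) 2)
    simpa using this
  have h2 := Finset.sum_le_sum fun t (_ : t ∈ Finset.univ) => h1 t
  simp only [Finset.sum_const, Finset.card_univ, Fintype.card_fin, nsmul_eq_mul] at h2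
  rw [lpPow, one_div, inv_mul_le_iff₀ hT']
  exact h2

theorem lpPow_two_smul (P : Measure (Traj T dx)) (a : ℝ) (f : Euc dx → Euc dy) :
    lpPow P 2 (a • f) = a ^ 2 * lpPow P 2 f := by
  simp only [lpPow, Pi.smul_apply, norm_smul, mul_pow, Real.norm_eq_abs, sq_abs,
    integral_const_mul, ← Finset.mul_sum]
  ring

theorem empSq_smul (x : Traj T dx) (a : ℝ) (f : Euc dx → Euc dy) :
    empSq x (a • f) = a ^ 2 * empSq x f := by
  simp only [empSq, Pi.smul_apply, norm_smul, mul_pow, Real.norm_eq_abs, sq_abs,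
    ← Finset.mul_sum]
  ring

/-- The lower isometry passes from `g` to any `f` close to it in supremum norm. -/
theorem empSq_ge_of_close (hT : 0 < T) {S : Set (Euc dx)} {x : Traj T dx} (hx : ∀ t, x t ∈ S)
    {f g : Euc dx → Euc dy} {r : ℝ} (hr : 0 ≤ r)
    (hfg : supNormOn S (f - g) ≤ ENNReal.ofReal (r / √8)) (hg : r ^ 2 / 2 < empSq x g) :
    r ^ 2 / 8 ≤ empSq x f := by
  have hT' : (0 : ℝ) < T := by exact_mod_cast hT
  have h1 : ∀ t, ‖g (x t)‖ ^ 2 ≤ 2 * ‖f (x t)‖ ^ 2 + r ^ 2 / 4 := by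
    intro t
    have a1 : ‖(f - g) (x t)‖ ≤ r / √8 := norm_le_of_supNormOn_le (by positivity) hfg (hx t)
    have a2 : ‖g (x t)‖ ≤ ‖f (x t)‖ + ‖(f - g) (x t)‖ := by
      rw [Pi.sub_apply]; exact norm_le_norm_add_norm_sub _ _
    have a3 : ‖(f - g) (x t)‖ ^ 2 ≤ r ^ 2 / 8 := by
      have := pow_le_pow_left₀ (norm_nonneg _) a1 2
      rwa [div_pow, Real.sq_sqrt (by norm_num)] at this
    have a4 := pow_le_pow_left₀ (norm_nonneg _) a2 2
    nlinarith [sq_nonneg (‖f (x t)‖ - ‖(f - g) (x t)‖)]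
  have h2 : empSq x g ≤ 2 * empSq x f + r ^ 2 / 4 := by
    have := Finset.sum_le_sum fun t (_ : t ∈ Finset.univ) => h1 t
    simp only [Finset.sum_add_distrib, ← Finset.mul_sum, Finset.sum_const, Finset.card_univ,
      Fintype.card_fin, nsmul_eq_mul] at this
    rw [empSq, empSq, one_div, inv_mul_le_iff₀ hT']
    refine this.trans (le_of_eq ?_)
    field_simp
  linarith

/-- By star-shapedness, a lower isometry on a net of the sphere of radius `r` extends to every
function of the class outside the ball of radius `r`. -/
theorem lpPow_le_of_forall_net (hT : 0 < T) {P : Measure (Traj T dx)} {S : Set (Euc dx)}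
    {x : Traj T dx} (hx : ∀ t, x t ∈ S) {H : Set (Euc dx → Euc dy)} (hstar : StarConvex ℝ 0 H)
    {r : ℝ} (hr : 0 < r) {N : Finset (Euc dx → Euc dy)}
    (hnet : IsSupNet S N (l2Sphere P H r) (r / √8)) (hN : ∀ g ∈ N, r ^ 2 / 2 < empSq x g)
    {f : Euc dx → Euc dy} (hf : f ∈ H) (hfr : r ^ 2 < lpPow P 2 f) :
    lpPow P 2 f ≤ 8 * empSq x f := by
  set ρ := lpPow P 2 f
  have hρ : 0 < ρ := (by positivity : (0 : ℝ) < r ^ 2).trans hfr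
  set a := r / √ρ with ha
  have ha2 : a ^ 2 = r ^ 2 / ρ := by rw [ha, div_pow, Real.sq_sqrt hρ.le]
  have ha0 : 0 < a := div_pos hr (Real.sqrt_pos.2 hρ)
  have ha1 : a ≤ 1 := (div_le_one (Real.sqrt_pos.2 hρ)).2 (Real.le_sqrt_of_sq_le hfr.le)
  have hmem : a • f ∈ l2Sphere P H r := by
    refine ⟨hstar.smul_mem hf ha0.le ha1, ?_⟩
    rw [lpPow_two_smul, ha2, div_mul_cancel₀ _ hρ.ne']
  obtain ⟨g, hg, hfg⟩ := hnet.2 _ hmem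
  have h1 := empSq_ge_of_close hT hx hr.le hfg (hN g hg)
  rw [empSq_smul, ha2] at h1
  have h2 := mul_le_mul_of_nonneg_left h1 (by positivity : 0 ≤ 8 * ρ / r ^ 2)
  have e1 : 8 * ρ / r ^ 2 * (r ^ 2 / 8) = ρ := by field_simp
  have e2 : 8 * ρ / r ^ 2 * (r ^ 2 / ρ * empSq x f) = 8 * empSq x f := by field_simp
  rwa [e1, e2] at h2

end

/-! ### The excess risk bound -/

theorem theorem1 {Ω : Type*} [mΩ : MeasurableSpace Ω] (μ : Measure Ω) [IsProbabilityMeasure μ]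
    {T dx dy : ℕ} (hT : 0 < T)
    (ℱ : Filtration ℤ mΩ) (S : Set (Euc dx))
    (F : Set (Euc dx → Euc dy)) (hF : ∀ f ∈ F, Measurable f)
    (fstar : Euc dx → Euc dy) (hfstar : fstar ∈ F)
    (X : Fin T → Ω → Euc dx) (Y W : Fin T → Ω → Euc dy)
    (hmodel : IsRegressionModel μ ℱ S fstar X Y W)
    (B : ℝ) (hB : 0 < B) (C : ℝ → ℝ) (hC : ∀ s ∈ Set.Ioc 0 B, 0 < C s)
    (α : ℝ) (hα : α ∈ Set.Icc (1 : ℝ) 2) (r : ℝ) (hr : r ∈ Set.Ioc 0 B)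
    (hstar : StarConvex ℝ 0 (shiftedClass F fstar))
    (hbdd : IsBoundedClass S (shiftedClass F fstar) B)
    (Fr : Finset (Euc dx → Euc dy))
    (hnet : IsSupNet S Fr (l2Sphere (trajLaw μ X) (shiftedClass F fstar) r) (r / √8))
    (hhyp : TrajectoryHypercontractive (Fr : Set (Euc dx → Euc dy)) (trajLaw μ X) (C r) α)
    (fhat : Ω → Euc dx → Euc dy)
    (hfhat : ∀ᵐ ω ∂μ, IsLeastSquares F (fun t => X t ω) (fun t => Y t ω) (fhat ω))
    (hrisk : AEMeasurable (fun ω => lpPow (trajLaw μ X) 2 (fhat ω - fstar)) μ)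
    (hcomp : AEMeasurable
      (fun ω => offsetComplexity (shiftedClass F fstar) (fun t => W t ω) (fun t => X t ω)) μ) :
    Integrable (fun ω => lpPow (trajLaw μ X) 2 (fhat ω - fstar)) μ ∧
    Integrable
      (fun ω => offsetComplexity (shiftedClass F fstar) (fun t => W t ω) (fun t => X t ω)) μ ∧
    ∫ ω, lpPow (trajLaw μ X) 2 (fhat ω - fstar) ∂μ ≤
      8 * ∫ ω, offsetComplexity (shiftedClass F fstar) (fun t => W t ω) (fun t => X t ω) ∂μ
        + r ^ 2
        + B ^ 2 * (Fr.card : ℝ) *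
          Real.exp (-((T : ℝ) * r ^ (4 - 2 * α)) /
            (8 * C r * matOpNorm (dependencyMatrix (trajLaw μ X)) ^ 2)) := by
  have hT' : (0 : ℝ) < T := by exact_mod_cast hT
  obtain ⟨hr0, hrB⟩ := hr
  have hXm : ∀ t, Measurable (X t) := fun t => (hmodel.covariate_adapted t).mono (ℱ.le _) le_rfl
  have hX : Measurable (fun ω t => X t ω) := measurable_pi_lambda _ hXm
  set P := trajLaw μ X with hPdef
  have hP : IsProbabilityMeasure P := Measure.isProbabilityMeasure_map hX.aemeasurable
  set H := shiftedClass F fstar with hHdef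
  have hHm : ∀ f ∈ H, Measurable f := by
    rintro _ ⟨f, hf, rfl⟩
    exact (hF f hf).sub (hF fstar hfstar)
  have hHB : ∀ f ∈ H, ∀ᵐ x ∂P, ∀ t, ‖f (x t)‖ ≤ B := by
    intro f hf
    refine (ae_map_iff hX.aemeasurable ?_).2 (.of_forall fun ω t =>
      norm_le_of_supNormOn_le hB.le (hbdd f hf) (hmodel.covariate_mem t ω))
    rw [Set.ofPred_forall]
    exact MeasurableSet.iInter fun t =>
      measurableSet_le ((hHm f hf).comp (measurable_pi_apply t)).norm measurable_const
  have h0H : (0 : Euc dx → Euc dy) ∈ H := zero_mem_shiftedClass hfstar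
  have hfhatH : ∀ᵐ ω ∂μ, fhat ω - fstar ∈ H := hfhat.mono fun ω h => ⟨_, h.1, rfl⟩
  have hriskB : ∀ᵐ ω ∂μ, lpPow P 2 (fhat ω - fstar) ≤ B ^ 2 :=
    hfhatH.mono fun ω h => lpPow_two_le P hT (hHB _ h)
  have hriskInt : Integrable (fun ω => lpPow P 2 (fhat ω - fstar)) μ := by
    refine Integrable.of_bound hrisk.aestronglyMeasurable (B ^ 2) (hriskB.mono fun ω h => ?_)
    rwa [Real.norm_of_nonneg (lpPow_two_nonneg _ _)]
  have hcompInt : Integrable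
      (fun ω => offsetComplexity H (fun t => W t ω) (fun t => X t ω)) μ := by
    have hW : Integrable (fun ω => (1 / (T : ℝ)) * ∑ t : Fin T, 4 * ‖W t ω‖ ^ 2) μ :=
      (integrable_finsetSum _ fun t _ =>
        ((hmodel.noise_sq_integrable t).integrable_norm_pow two_ne_zero).const_mul 4).const_mul _
    refine hW.mono' hcomp.aestronglyMeasurable (.of_forall fun ω => ?_)
    rw [Real.norm_of_nonneg (offsetComplexity_nonneg h0H _ _)]
    exact offsetComplexity_le h0H _ _
  refine ⟨hriskInt, hcompInt, ?_⟩
  set δ := Real.exp (-((T : ℝ) * r ^ (4 - 2 * α)) /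
    (8 * C r * matOpNorm (dependencyMatrix P) ^ 2)) with hδ
  let bad : (Euc dx → Euc dy) → Set Ω := fun g => {ω | empSq (fun t => X t ω) g ≤ r ^ 2 / 2}
  have hFrH : ∀ g ∈ Fr, g ∈ H ∧ lpPow P 2 g = r ^ 2 := fun g hg => hnet.1 g hg
  have hbadm : ∀ g ∈ Fr, MeasurableSet (bad g) := fun g hg =>
    measurableSet_le ((measurable_empSq (hHm g (hFrH g hg).1)).comp hX) measurable_const
  have hbad : ∀ g ∈ Fr, μ.real (bad g) ≤ δ := by
    intro g hg
    have hgm := hHm g (hFrH g hg).1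
    have h1 := measureReal_empSq_le_half_le hT P hgm (hHB g (hFrH g hg).1) hr0
      (hC r ⟨hr0, hrB⟩) (hFrH g hg).2 (hhyp g hg)
    rwa [hPdef, trajLaw, map_measureReal_apply hX
      (measurableSet_le (measurable_empSq hgm) measurable_const)] at h1
  set E : Set Ω := ⋃ g ∈ Fr, bad g with hEdef
  have hEm : MeasurableSet E := Finset.measurableSet_biUnion _ hbadm
  have hEμ : μ.real E ≤ Fr.card * δ :=
    calc μ.real E ≤ ∑ g ∈ Fr, μ.real (bad g) := measureReal_biUnion_finset_le _ _
      _ ≤ ∑ _g ∈ Fr, δ := Finset.sum_le_sum hbad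
      _ = Fr.card * δ := by rw [Finset.sum_const, nsmul_eq_mul]
  have hpt : ∀ᵐ ω ∂μ, lpPow P 2 (fhat ω - fstar) ≤
      8 * offsetComplexity H (fun t => W t ω) (fun t => X t ω) + r ^ 2
        + E.indicator (fun _ => B ^ 2) ω := by
    filter_upwards [hfhat, hfhatH, hriskB] with ω h1 h2 h3
    have hM0 := offsetComplexity_nonneg h0H (fun t => W t ω) (fun t => X t ω)
    have hr2 := sq_nonneg r
    by_cases hω : ω ∈ E
    · rw [Set.indicator_of_mem hω]
      linarith
    rw [Set.indicator_of_notMem hω]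
    rcases le_or_gt (lpPow P 2 (fhat ω - fstar)) (r ^ 2) with h4 | h4
    · linarith
    have h5 : ∀ g ∈ Fr, r ^ 2 / 2 < empSq (fun t => X t ω) g := fun g hg =>
      not_le.1 fun h => hω (Set.mem_biUnion hg h)
    have h6 := lpPow_le_of_forall_net hT (fun t => hmodel.covariate_mem t ω) hstar hr0 hnet h5
      h2 h4
    have h7 := empSq_le_offsetComplexity hfstar (fun t => hmodel.model t ω) h1
    linarith
  have hindInt : Integrable (E.indicator fun _ => B ^ 2) μ :=
    (integrable_const (B ^ 2)).indicator hEm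
  calc ∫ ω, lpPow P 2 (fhat ω - fstar) ∂μ
      ≤ ∫ ω, (8 * offsetComplexity H (fun t => W t ω) (fun t => X t ω) + r ^ 2
        + E.indicator (fun _ => B ^ 2) ω) ∂μ :=
        integral_mono_ae hriskInt (((hcompInt.const_mul 8).add (integrable_const _)).add hindInt)
          hpt
    _ = 8 * ∫ ω, offsetComplexity H (fun t => W t ω) (fun t => X t ω) ∂μ + r ^ 2
        + μ.real E * B ^ 2 := by
        rw [integral_add (by exact (hcompInt.const_mul 8).add (integrable_const _)) hindInt,
          integral_add (hcompInt.const_mul 8) (integrable_const _), integral_const_mul,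
          integral_indicator_const _ hEm]
        simp
    _ ≤ _ := by
        have := mul_le_mul_of_nonneg_right hEμ (sq_nonneg B)
        linarith
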